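/- **Setting.** Let $K\ge 2$ and $T\ge 2K$ be integers, let $G=([K],E)$ be a directed graph (self-loops allowed), and write $N^{\rm in}(i)=\{j:(j,i)\in E\}$. Assume that $G$ is strongly observable: every $i$ satisfies $i\in N^{\rm in}(i)$ or $N^{\rm in}(i)=[K]\setminus\{i\}$, and $N^{\rm in}(i)\neq\emptyset$. An adversary fixes loss vectors $\ell_1,\dots,\ell_T\in[0,1]^K$ in advance. In round $t$ the learner pulls an arm $i_t$, suffers $\ell_{t,i_t}$, and observes $\ell_{t,i}$ for all $i$ with $i_t\in N^{\rm in}(i)$. Put $L_i=\sum_{t=1}^T\ell_{t,i}$, let $i^\star$ be an arm minimizing $L_i$, $L_\star=L_{i^\star}$, and $\mathrm{Reg}=\mathbb E\big[\sum_{t=1}^T\ell_{t,i_t}\big]-L_\star$, the expectation being over the learner's randomness. Let $S=\{i: i\in N^{\rm in}(i)\}$, $\bar S=[K]\setminus S$, and let $\mathcal C_1,\dots,\mathcal C_\kappa$ be any partition of $S$ into $\kappa$ nonempty cliques (sets in which $(i,i')\in E$ for all distinct $i,i'$). The meta-nodes are the $\kappa$ cliques and the nodes of $\bar S$; let $\beta=\kappa+|\bar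 S|$ be their number. $D_\psi(x,y)=\psi(x)-\psi(y)-\langle\nabla\psi(y),x-y\rangle$ is the Bregman divergence, and $\Delta$ denotes the probability simplex. **Hedge instance on $C\subseteq[K]$.** It starts with $\widetilde p_1$ uniform on $C$. After it is fed its $t$-th loss vector $\widetilde\ell_t$, it sets $\widetilde p_{t+1}=\arg\min_p\{\langle p,\widetilde\ell_t\rangle+D_{\phi_t}(p,\widetilde p_t)\}$ over $\{p\in\Delta([K]):p_i\ge\frac1{|C|T}\ (i\in C),\ p_i=0\ (i\notin C)\}$, where $\phi_t(p)=\frac1{\eta_t}\sum_i p_i\ln p_i$, $\eta_t=\big(1+\sum_{\tau\le t}\sum_i\widetilde p_{\tau,i}\widetilde\ell_{\tau,i}^2\big)^{-1/2}$ (the divergence is taken on the coordinates in $C$). **The algorithm**, with parameters $c$ and $\eta$. Let $\Omega=\{p\in\Delta(\text{meta-nodes}):p_j\ge\frac1T\ \forall j\}$ and $$\psi_t(p)=\sum_{j\in[\kappa]}\frac1{\eta_{t,j}}\ln\frac1{p_j}+\frac1\eta\sum_{j\in\bar S}p_j\ln p_j+c\sum_{j\in\bar S}\ln\frac1{p_j}.$$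 *(Re)start* before round $t$: set $\eta_{t,j}=\eta$ and $\rho_{t,j}=2\kappa$ for $j\in[\kappa]$, set $p_t=\arg\min_{p\in\Omega}\psi_t(p)$, and create a new Hedge instance $\mathcal A_j$ on each $\mathcal C_j$. The algorithm starts before round $1$, and in each round $t=1,\dots,T$: 1. $\mathcal A_j$ proposes $\widetilde p^{(j)}_t$. Draw a meta-node $j_t\sim p_t$. If $j_t\in[\kappa]$, draw $i_t\sim\widetilde p_t^{(j_t)}$; otherwise $i_t=j_t$. Pull $i_t$. 2. Set $\widetilde\ell_{t,i}=\frac{\ell_{t,i}}{p_{t,j_t}}\mathbf 1\{j_t\in[\kappa],\,i\in\mathcal C_{j_t}\}$ for $i\in S$ and $\widetilde\ell_{t,i}=\frac{\ell_{t,i}}{1-p_{t,i}}\mathbf 1\{i\ne i_t\}$ for $i\in\bar S$; feed $\widetilde\ell_t$ to every $\mathcal A_j$. Set $\hat\ell_{t,j}=\langle\widetilde p_t^{(j)},\widetilde\ell_t\rangle$ for $j\in[\kappa]$ and $\hat\ell_{t,j}=\widetilde\ell_{t,j}$ for $j\in\bar S$. 3. Set $p_{t+1}=\arg\min_{p\in\Omega}\{\langle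 p,\hat\ell_t\rangle+D_{\psi_t}(p,p_t)\}$. For each $j\in[\kappa]$: if $1/p_{t+1,j}>\rho_{t,j}$, set $\rho_{t+1,j}=2/p_{t+1,j}$ and $\eta_{t+1,j}=\eta_{t,j}e^{1/\ln T}$; otherwise $\rho_{t+1,j}=\rho_{t,j}$ and $\eta_{t+1,j}=\eta_{t,j}$. 4. If $\frac{\kappa+1}{\eta}\le\eta\sum_{\tau}\langle p_\tau,\hat\ell_\tau\rangle$, the sum being over the rounds $\tau\le t$ since the last (re)start, replace $\eta$ by $\eta/2$ and restart before round $t+1$. **Theorem.** There are absolute constants $A$ and $m\in\mathbb N$ such that, for all $K$, $T$, $G$, $\ell_1,\dots,\ell_T$ and $\mathcal C_1,\dots,\mathcal C_\kappa$ as above, the algorithm with $c=64\beta$ and initial value $\eta=\frac1{2000(\ln T)\ln^2(KT)+80\kappa\ln T}$ (which does not depend on $L_\star$) satisfies $$\mathrm{Reg}\le A\,\ln^m(KT)\,\Big(\sqrt{(\kappa+1)L_\star}+\beta^2\Big).$$ In other words, $\mathrm{Reg}=\tilde{\mathcal O}\big(\sqrt{(\kappa+1)L_\star}+\beta^2\big)$.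 -/

import Mathlib

open Finset

noncomputable section

namespace GraphBandit

/-! ### Feedback graphs -/

/-- `N^in(i)`, the set of nodes that can observe `i`. -/
def inNbrs {K : ℕ} (G : Digraph (Fin K)) (i : Fin K) : Set (Fin K) := {j | G.Adj j i}

/-- Every node is observable, and moreover has a self-loop or is observed by all the other
nodes. -/
def StronglyObservable {K : ℕ} (G : Digraph (Fin K)) : Prop :=
  ∀ i, (inNbrs G i).Nonempty ∧ (i ∈ inNbrs G i ∨ inNbrs G i = {i}ᶜ)

/-- `C 0, …, C (κ - 1)` is a partition into nonempty cliques of the set `S` of nodes with a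
self-loop. -/
structure IsCliquePartition {K κ : ℕ} (G : Digraph (Fin K)) (C : Fin κ → Finset (Fin K)) :
    Prop where
  nonempty : ∀ j, (C j).Nonempty
  disjoint : ∀ j j', j ≠ j' → Disjoint (C j) (C j')
  covers : ∀ i, (∃ j, i ∈ C j) ↔ i ∈ inNbrs G i
  clique : ∀ j, ∀ i ∈ C j, ∀ i' ∈ C j, i ≠ i' → G.Adj i i'

/-- The set `S̄` of nodes without a self-loop, as a type. -/
abbrev NoLoop {K : ℕ} (G : Digraph (Fin K)) : Type := {i : Fin K // i ∉ inNbrs G i}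

instance {K : ℕ} (G : Digraph (Fin K)) : Fintype (NoLoop G) := Fintype.ofFinite _

/-- The meta-nodes: the `κ` cliques, and the nodes without a self-loop. -/
abbrev Meta {K : ℕ} (G : Digraph (Fin K)) (κ : ℕ) : Type := Fin κ ⊕ NoLoop G

/-- The number of meta-nodes, `β = κ + |S̄|`. -/
def metaCard {K : ℕ} (G : Digraph (Fin K)) (κ : ℕ) : ℕ := Fintype.card (Meta G κ)

/-! ### Mirror descent -/

/-- A minimizer of `f` over `s` (an arbitrary vector if there is none). -/
def argminOn {ι : Type*} (s : Set (ι → ℝ)) (f : (ι → ℝ) → ℝ) : ι → ℝ :=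
  Classical.epsilon fun x => x ∈ s ∧ IsMinOn f s x

/-- The Bregman divergence `ψ(x) - ψ(y) - ⟨∇ψ(y), x - y⟩`. The last term is written as the
derivative of `ψ` at `y` in the direction `x - y`, so that it also makes sense on a face of the
simplex, where coordinates that vanish in both `x` and `y` do not matter. -/
def bregman {ι : Type*} [Fintype ι] (ψ : (ι → ℝ) → ℝ) (x y : ι → ℝ) : ℝ :=
  ψ x - ψ y - lineDeriv ℝ ψ y (x - y)

/-- The mirror descent update `argmin_{p ∈ s} ⟨p, g⟩ + D_ψ(p, q)`. -/
def omdStep {ι : Type*} [Fintype ι] (s : Set (ι → ℝ)) (ψ : (ι → ℝ) → ℝ) (g q : ι → ℝ) :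
    ι → ℝ :=
  argminOn s fun p => p ⬝ᵥ g + bregman ψ p q

/-! ### Hedge with adaptive learning rates, on the set `C` of active arms -/

/-- The state of a Hedge instance: the distribution it proposes, and the sum
`∑_τ ∑_i p̃_{τ,i} ℓ̃_{τ,i}²` over the rounds `τ` it has been through. -/
structure HedgeState (K : ℕ) where
  prob : Fin K → ℝ
  sqSum : ℝ

open Classical in
/-- A new Hedge instance proposes the uniform distribution over `C`. -/
def hedgeInit {K : ℕ} (C : Finset (Fin K)) : HedgeState K where
  prob i := if i ∈ C then 1 / (C.card : ℝ) else 0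
  sqSum := 0

/-- The decision set of Hedge. -/
def hedgeDomain {K : ℕ} (T : ℕ) (C : Finset (Fin K)) : Set (Fin K → ℝ) :=
  {p | p ∈ stdSimplex ℝ (Fin K) ∧ (∀ i ∈ C, 1 / ((C.card : ℝ) * T) ≤ p i) ∧ ∀ i ∉ C, p i = 0}

/-- The entropy regularizer with learning rate `η`. -/
def entropyReg {K : ℕ} (η : ℝ) (p : Fin K → ℝ) : ℝ := 1 / η * ∑ i, p i * Real.log (p i)

/-- The state of a Hedge instance after it has been fed the loss vector `g`. -/
def hedgeStep {K : ℕ} (T : ℕ) (C : Finset (Fin K)) (h : HedgeState K) (g : Fin K → ℝ) :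
    HedgeState K :=
  let V := h.sqSum + ∑ i, h.prob i * g i ^ 2
  { prob := omdStep (hedgeDomain T C) (entropyReg √(1 / (1 + V))) g h.prob
    sqSum := V }

/-! ### The adaptive algorithm -/

/-- The state of the algorithm at the beginning of a round `t`. -/
structure State {K : ℕ} (G : Digraph (Fin K)) (κ : ℕ) where
  /-- the current value of `η` -/
  eta : ℝ
  /-- the learning rates `η_{t,j}` of the cliques -/
  rate : Fin κ → ℝ
  /-- the thresholds `ρ_{t,j}` -/
  rho : Fin κ → ℝ
  /-- the distribution `p_t` over the meta-nodes -/
  p : Meta G κ → ℝ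
  /-- the Hedge instances -/
  hedge : Fin κ → HedgeState K
  /-- the estimated cumulative loss `∑ ⟨p_τ, ℓ̂_τ⟩` over the past rounds `τ` since the last
  reset -/
  cumLoss : ℝ

/-- The hybrid regularizer: log-barrier with the rates `η_{t,j}` for the cliques, and entropy with
rate `η` plus `c` times the log-barrier for the nodes without a self-loop. -/
def hybridReg {K κ : ℕ} {G : Digraph (Fin K)} (c η : ℝ) (rate : Fin κ → ℝ) (p : Meta G κ → ℝ) :
    ℝ :=
  ∑ j : Fin κ, 1 / rate j * Real.log (1 / p (.inl j))
    + 1 / η * ∑ v : NoLoop G, p (.inr v) * Real.log (p (.inr v))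
    + c * ∑ v : NoLoop G, Real.log (1 / p (.inr v))

/-- The decision set `Ω` of the meta-algorithm. -/
def metaDomain {K : ℕ} (T : ℕ) (G : Digraph (Fin K)) (κ : ℕ) : Set (Meta G κ → ℝ) :=
  {p | p ∈ stdSimplex ℝ (Meta G κ) ∧ ∀ j, 1 / (T : ℝ) ≤ p j}

/-- The state after a (re)start with learning rate `η`. -/
def restart {K κ : ℕ} (T : ℕ) (G : Digraph (Fin K)) (C : Fin κ → Finset (Fin K)) (c η : ℝ) :
    State G κ where
  eta := η
  rate _ := η
  rho _ := 2 * κ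
  p := argminOn (metaDomain T G κ) (hybridReg c η fun _ => η)
  hedge j := hedgeInit (C j)
  cumLoss := 0

/-- The random choices of one round: the meta-node `j_t` and the arm `i_t`. -/
abbrev Choice {K : ℕ} (G : Digraph (Fin K)) (κ : ℕ) : Type := Meta G κ × Fin K

open Classical in
/-- The probability of drawing `(j_t, i_t)` in state `s`: the meta-node `j_t` is drawn from `p_t`;
if it is a clique, then `i_t` is drawn from the distribution of its Hedge instance, otherwise
`i_t = j_t`. -/
def choiceProb {K κ : ℕ} {G : Digraph (Fin K)} (s : State G κ) : Choice G κ → ℝ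
  | (.inl j, i) => s.p (.inl j) * (s.hedge j).prob i
  | (.inr v, i) => if i = v then s.p (.inr v) else 0

open Classical in
/-- The feedback when arm `a` is pulled: the losses of the arms that `a` observes (the unobserved
losses are replaced by zero). -/
def feedback {K : ℕ} (G : Digraph (Fin K)) (loss : Fin K → ℝ) (a : Fin K) (i : Fin K) : ℝ :=
  if a ∈ inNbrs G i then loss i else 0

open Classical in
/-- The estimator `ℓ̃_t`, computed from the feedback `fb` when the choices are `(j_t, i_t)`. -/
def armEstimator {K κ : ℕ} {G : Digraph (Fin K)} (C : Fin κ → Finset (Fin K)) (s : State G κ)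
    (x : Choice G κ) (fb : Fin K → ℝ) (i : Fin K) : ℝ :=
  if h : i ∈ inNbrs G i then
    match x.1 with
    | .inl j => if i ∈ C j then fb i / s.p (.inl j) else 0
    | .inr _ => 0
  else if i ≠ x.2 then fb i / (1 - s.p (.inr ⟨i, h⟩)) else 0

/-- The estimator `ℓ̂_t` for the meta-nodes, computed from `ℓ̃_t`. -/
def metaEstimator {K κ : ℕ} {G : Digraph (Fin K)} (s : State G κ) (est : Fin K → ℝ) :
    Meta G κ → ℝ
  | .inl j => (s.hedge j).prob ⬝ᵥ est
  | .inr v => est v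

open Classical in
/-- One round of the algorithm with horizon `T`: the state at the beginning of the next round, when
the choices are `x = (j_t, i_t)` and the loss vector is `loss`. -/
def step {K κ : ℕ} (T : ℕ) (G : Digraph (Fin K)) (C : Fin κ → Finset (Fin K)) (c : ℝ)
    (loss : Fin K → ℝ) (s : State G κ) (x : Choice G κ) : State G κ :=
  let est := armEstimator C s x (feedback G loss x.2)
  let mest := metaEstimator s est
  let p' := omdStep (metaDomain T G κ) (hybridReg c s.eta s.rate) mest s.p
  let cum := s.cumLoss + s.p ⬝ᵥ mest
  if ((κ : ℝ) + 1) / s.eta ≤ s.eta * cum then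
    restart T G C c (s.eta / 2)
  else
    { eta := s.eta
      rate := fun j =>
        if s.rho j < 1 / p' (.inl j) then s.rate j * Real.exp (1 / Real.log T) else s.rate j
      rho := fun j => if s.rho j < 1 / p' (.inl j) then 2 / p' (.inl j) else s.rho j
      p := p'
      hedge := fun j => hedgeStep T (C j) (s.hedge j) est
      cumLoss := cum }

/-! ### The law of the run and the regret

The loss vectors are `ℓ 0, …, ℓ (T - 1)`, and `ω : Fin n → Choice G κ` lists the random choices
of the first `n` rounds. -/

/-- The state after `n` rounds with choices `ω`, when the initial learning rate is `η`. -/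
def stateAfter {K κ : ℕ} (T : ℕ) (G : Digraph (Fin K)) (C : Fin κ → Finset (Fin K)) (c η : ℝ)
    (ℓ : ℕ → Fin K → ℝ) : (n : ℕ) → (Fin n → Choice G κ) → State G κ
  | 0, _ => restart T G C c η
  | n + 1, ω => step T G C c (ℓ n) (stateAfter T G C c η ℓ n (Fin.init ω)) (ω (Fin.last n))

/-- The probability that the choices of the first `n` rounds are `ω`. -/
def runProb {K κ : ℕ} (T : ℕ) (G : Digraph (Fin K)) (C : Fin κ → Finset (Fin K)) (c η : ℝ)
    (ℓ : ℕ → Fin K → ℝ) : (n : ℕ) → (Fin n → Choice G κ) → ℝ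
  | 0, _ => 1
  | n + 1, ω => runProb T G C c η ℓ n (Fin.init ω) *
      choiceProb (stateAfter T G C c η ℓ n (Fin.init ω)) (ω (Fin.last n))

/-- The total loss `L_i` of arm `i`. -/
def armLoss {K : ℕ} (T : ℕ) (ℓ : ℕ → Fin K → ℝ) (i : Fin K) : ℝ := ∑ t ∈ range T, ℓ t i

/-- The regret with respect to arm `i`: the expectation of `∑_t ℓ_{t,i_t} - ∑_t ℓ_{t,i}`. -/
def regret {K κ : ℕ} (T : ℕ) (G : Digraph (Fin K)) (C : Fin κ → Finset (Fin K)) (c η : ℝ)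
    (ℓ : ℕ → Fin K → ℝ) (i : Fin K) : ℝ :=
  ∑ ω : Fin T → Choice G κ,
    runProb T G C c η ℓ T ω * (∑ t : Fin T, ℓ t (ω t).2 - armLoss T ℓ i)

end GraphBandit

end

/-!
Follow a single run of the algorithm. Between two restarts it is online mirror descent over the
meta-nodes, run on top of one Hedge instance per clique. Two features make the cost of each epoch
of order `(κ + 1) / η + η ∑ ⟨p, ℓ̂⟩`, up to logarithms and the barrier term `c β`:

* the step size `η_j` of a clique grows each time `1 / p_j` doubles past its record `ρ_j`, and the
  resulting change of regularizer contributes a negative term proportional to `ρ_j / η`. It pays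
  for the regret of the Hedge instance on that clique, whose estimated losses can be as large as
  `1 / p_j`;
* the log-barrier on the nodes without a self-loop keeps `p` stable there although their estimated
  losses can be as large as `1 / (1 - p_i)`. At most one node has `p_i > 1 / 2`, and for that node
  adding a constant to all losses removes the large term.

The restart test halves `η` once the second summand overtakes the first, so `(κ + 1) / η` grows
geometrically over the epochs and the total cost is of order `√((κ + 1) Z)`, where `Z` is the sum
of `⟨p, ℓ̂⟩` over all rounds. The estimators are unbiased, hence `𝔼 Z` is the expected loss of
the learner, i.e. `Reg + L_⋆`. By Jensen's inequality `Reg` is bounded by a multiple of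
`√((κ + 1) (Reg + L_⋆))` plus lower order terms, which is then solved for `Reg`.
-/

namespace GraphBandit

noncomputable section

open Real InformationTheory

/-! ### Scalar inequalities -/

/-- The Bregman divergence between `x` and `1` of the log-barrier `-log`. For the negative entropy
`x log x` this divergence is `klFun`. -/
def barrierGap (x : ℝ) : ℝ := x - 1 - log x

lemma barrierGap_nonneg {x : ℝ} (hx : 0 < x) : 0 ≤ barrierGap x := by
  have := log_le_sub_one_of_pos hx
  unfold barrierGap
  linarith

lemma half_sub_log_two_le_barrierGap {x : ℝ} (hx : 0 < x) :
    x / 2 - log 2 ≤ barrierGap x := by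
  have hlog := log_le_sub_one_of_pos (half_pos hx)
  rw [log_div hx.ne' two_ne_zero] at hlog
  unfold barrierGap
  linarith

lemma sub_one_le_mul_barrierGap {c x : ℝ} (hc : 4 ≤ c) (hx : 2 ≤ x) :
    x - 1 ≤ c * barrierGap x := by
  have hx0 : 0 < x := by linarith
  calc x - 1 ≤ 4 * (x / 2 - log 2) := by linarith [log_two_lt_d9]
    _ ≤ 4 * barrierGap x := by gcongr; exact half_sub_log_two_le_barrierGap hx0
    _ ≤ c * barrierGap x := by gcongr; exact barrierGap_nonneg hx0

lemma sub_log_one_add_le {z : ℝ} (hz : -(1 / 2) ≤ z) : z - log (1 + z) ≤ 2 * z ^ 2 := by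
  have hpos : 0 < 1 + z := by linarith
  have hinv : (1 + z)⁻¹ ≤ 2 := (inv_le_comm₀ hpos two_pos).2 (by linarith)
  calc z - log (1 + z) ≤ z - (1 - (1 + z)⁻¹) := by gcongr; exact one_sub_inv_le_log_of_pos hpos
    _ = (1 + z)⁻¹ * z ^ 2 := by field_simp; ring
    _ ≤ 2 * z ^ 2 := by gcongr

/-- The Fenchel–Young inequality for `barrierGap`. -/
lemma mul_one_sub_sub_barrierGap_le {x z : ℝ} (hz : -1 < z) (hx : 0 < x) :
    z * (1 - x) - barrierGap x ≤ z - log (1 + z) := by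
  have hpos : 0 < 1 + z := by linarith
  have hlog := log_le_sub_one_of_pos (mul_pos hpos hx)
  rw [log_mul hpos.ne' hx.ne'] at hlog
  unfold barrierGap
  linarith

lemma barrier_stability {a x y : ℝ} (ha : 0 < a) (hy : -(1 / 2) ≤ a * y) (hx : 0 < x) :
    y * (1 - x) - 1 / a * barrierGap x ≤ 2 * a * y ^ 2 := by
  have hscaled : a * y * (1 - x) - barrierGap x ≤ 2 * (a * y) ^ 2 :=
    (mul_one_sub_sub_barrierGap_le (by linarith) hx).trans (sub_log_one_add_le hy)
  calc y * (1 - x) - 1 / a * barrierGap x = 1 / a * (a * y * (1 - x) - barrierGap x) := by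
        field_simp
    _ ≤ 1 / a * (2 * (a * y) ^ 2) := by gcongr
    _ = 2 * a * y ^ 2 := by field_simp

lemma sq_div_six_le_klFun {x : ℝ} (hx : 0 < x) (hx2 : x ≤ 2) :
    (x - 1) ^ 2 / 6 ≤ klFun x := by
  obtain ⟨r, hr, rfl⟩ : ∃ r : ℝ, 0 < r ∧ r ^ 2 = x := ⟨√x, sqrt_pos.2 hx, sq_sqrt hx.le⟩
  have hlog : r ^ 2 * (1 - r⁻¹) ≤ r ^ 2 * log r := by gcongr; exact one_sub_inv_le_log_of_pos hr
  have hsq : (r + 1) ^ 2 ≤ 6 := by nlinarith [sq_nonneg (r - 3 / 2)]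
  calc (r ^ 2 - 1) ^ 2 / 6 = (r - 1) ^ 2 * ((r + 1) ^ 2 / 6) := by ring
    _ ≤ (r - 1) ^ 2 * 1 := by gcongr; linarith
    _ = 2 * (r ^ 2 * (1 - r⁻¹)) + 1 - r ^ 2 := by field_simp; ring
    _ ≤ 2 * (r ^ 2 * log r) + 1 - r ^ 2 := by gcongr
    _ = klFun (r ^ 2) := by rw [klFun_apply, log_pow]; push_cast; ring

lemma entropy_stability_of_le_two {η p g x : ℝ} (hη : 0 < η) (hp : 0 < p) (hx : 0 < x)
    (hx2 : x ≤ 2) : p * g * (1 - x) - 1 / η * (p * klFun x) ≤ 2 * η * (p * g ^ 2) := by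
  have hscaled : η * g * (1 - x) - klFun x ≤ 2 * (η * g) ^ 2 := by
    nlinarith [sq_div_six_le_klFun hx hx2, sq_nonneg ((x - 1) + 3 * (η * g)), sq_nonneg (η * g)]
  calc p * g * (1 - x) - 1 / η * (p * klFun x)
      = p / η * (η * g * (1 - x) - klFun x) := by field_simp
    _ ≤ p / η * (2 * (η * g) ^ 2) := by gcongr
    _ = 2 * η * (p * g ^ 2) := by field_simp

lemma entropy_stability {η p g x : ℝ} (hη : 0 < η) (hp : 0 < p) (hg : 0 ≤ g) (hx : 0 < x) :
    p * g * (1 - x) - 1 / η * (p * klFun x) ≤ 2 * η * (p * g ^ 2) := by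
  rcases le_total x 2 with hx2 | hx2
  · exact entropy_stability_of_le_two hη hp hx hx2
  · have hgap : 0 ≤ 1 / η * (p * klFun x) := by have := klFun_nonneg hx.le; positivity
    have hlin : p * g * (1 - x) ≤ 0 :=
      mul_nonpos_of_nonneg_of_nonpos (by positivity) (by linarith)
    have hsq : 0 ≤ 2 * η * (p * g ^ 2) := by positivity
    linarith

/-- The log-barrier takes over from the entropy where `x` is large, so that a negative loss `g` is
allowed here. -/
lemma hybrid_stability {η c p g x : ℝ} (hη : 0 < η) (hc : 4 ≤ c) (hp : 0 < p)
    (hg : -1 ≤ p * g) (hx : 0 < x) :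
    p * g * (1 - x) - (1 / η * (p * klFun x) + c * barrierGap x) ≤ 2 * η * (p * g ^ 2) := by
  rcases le_total x 2 with hx2 | hx2
  · have hgap : 0 ≤ c * barrierGap x := mul_nonneg (by linarith) (barrierGap_nonneg hx)
    linarith [entropy_stability_of_le_two (g := g) hη hp hx hx2]
  · have hgap : 0 ≤ 1 / η * (p * klFun x) := by have := klFun_nonneg hx.le; positivity
    have hsq : 0 ≤ 2 * η * (p * g ^ 2) := by positivity
    nlinarith [sub_one_le_mul_barrierGap hc hx2]

lemma div_sqrt_one_add_le {V v : ℝ} (hV : 0 ≤ V) (hv : 0 ≤ v) :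
    v / √(1 + (V + v)) ≤ 2 * (√(1 + (V + v)) - √(1 + V)) := by
  have hV1 := sq_sqrt (show 0 ≤ 1 + V by linarith)
  have hVv := sq_sqrt (show 0 ≤ 1 + (V + v) by linarith)
  rw [div_le_iff₀ (sqrt_pos.2 (by linarith))]
  nlinarith [sq_nonneg (√(1 + (V + v)) - √(1 + V))]

/-! ### Mirror descent with a separable regularizer -/

lemma argminOn_spec {ι : Type*} {s : Set (ι → ℝ)} {f : (ι → ℝ) → ℝ}
    (h : ∃ x ∈ s, IsMinOn f s x) : argminOn s f ∈ s ∧ IsMinOn f s (argminOn s f) :=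
  Classical.epsilon_spec (p := fun x => x ∈ s ∧ IsMinOn f s x) h

lemma lineDeriv_nonneg_of_isMinOn {E : Type*} [AddCommGroup E] [Module ℝ E] {s : Set E}
    {f : E → ℝ} {x u : E} {d : ℝ} (hs : Convex ℝ s) (hx : x ∈ s) (hu : u ∈ s)
    (hmin : IsMinOn f s x) (hd : HasLineDerivAt ℝ f d x (u - x)) : 0 ≤ d := by
  have hslope := (hasDerivAt_iff_tendsto_slope_zero.1 hd).mono_left
    (nhdsWithin_mono (0 : ℝ) fun t (ht : t ∈ Set.Ioi (0 : ℝ)) => ne_of_gt ht)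
  refine ge_of_tendsto hslope ?_
  filter_upwards [Ioo_mem_nhdsGT (zero_lt_one' ℝ)] with t ht
  have hle : f x ≤ f (x + t • (u - x)) := hmin (hs.add_smul_sub_mem hx hu ⟨ht.1.le, ht.2.le⟩)
  simp only [zero_add, zero_smul, add_zero, smul_eq_mul]
  exact mul_nonneg (inv_nonneg.2 ht.1.le) (sub_nonneg.2 hle)

section Separable

variable {ι : Type*} {s : Set (ι → ℝ)} {f f' : ι → ℝ → ℝ}

/-- In every coordinate that is not constant on `s`, the derivative of `f i` at the points of `s`
is `f' i`. Coordinates that are constant on `s` are exempt because on a face of the simplex the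
entropy has no derivative in the coordinates that vanish there. -/
def HasCoordDerivOn (f f' : ι → ℝ → ℝ) (s : Set (ι → ℝ)) : Prop :=
  ∀ p ∈ s, ∀ i, HasDerivAt (f i) (f' i (p i)) (p i) ∨ ∀ q ∈ s, q i = p i

lemma HasCoordDerivOn.omdObjective (hf : HasCoordDerivOn f f' s) (g q : ι → ℝ) :
    HasCoordDerivOn (fun i t => t * g i + (f i t - f i (q i) - f' i (q i) * (t - q i)))
      (fun i t => g i + (f' i t - f' i (q i))) s := by
  refine fun p hp i => (hf p hp i).imp_left fun hderiv => ?_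
  have hloss : HasDerivAt (fun t : ℝ => t * g i) (g i) (p i) := by
    simpa using (hasDerivAt_id (p i)).mul_const (g i)
  have hlin : HasDerivAt (fun t : ℝ => f' i (q i) * (t - q i)) (f' i (q i)) (p i) := by
    simpa using ((hasDerivAt_id (p i)).sub_const (q i)).const_mul (f' i (q i))
  exact hloss.add ((hderiv.sub_const _).sub hlin)

variable [Fintype ι]

/-- The Bregman divergence of the separable function `p ↦ ∑ i, f i (p i)`, where `f' i` is the
derivative of `f i`. -/
def separableDiv (f f' : ι → ℝ → ℝ) (x y : ι → ℝ) : ℝ :=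
  ∑ i, (f i (x i) - f i (y i) - f' i (y i) * (x i - y i))

lemma separableDiv_three_point (u p q : ι → ℝ) :
    separableDiv f f' u q - separableDiv f f' u p - separableDiv f f' p q
      = ∑ i, (f' i (p i) - f' i (q i)) * (u i - p i) := by
  simp only [separableDiv, ← sum_sub_distrib]
  exact sum_congr rfl fun i _ => by ring

lemma hasLineDerivAt_separable {g : ι → ℝ} {y d : ι → ℝ}
    (h : ∀ i, HasDerivAt (f i) (g i) (y i) ∨ d i = 0) :
    HasLineDerivAt ℝ (fun p : ι → ℝ => ∑ i, f i (p i)) (∑ i, g i * d i) y d := by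
  refine HasDerivAt.fun_sum fun i _ => ?_
  simp only [Pi.add_apply, Pi.smul_apply, smul_eq_mul]
  rcases h i with hderiv | hzero
  · have hline : HasDerivAt (fun t : ℝ => y i + t * d i) (d i) 0 := by
      simpa using ((hasDerivAt_id (0 : ℝ)).mul_const (d i)).const_add (y i)
    have hderiv' : HasDerivAt (f i) (g i) (y i + 0 * d i) := by simpa using hderiv
    exact hderiv'.comp 0 hline
  · simp only [hzero, mul_zero, add_zero]
    exact hasDerivAt_const _ _

lemma HasCoordDerivOn.hasLineDerivAt (hf : HasCoordDerivOn f f' s) {x y : ι → ℝ} (hx : x ∈ s)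
    (hy : y ∈ s) : HasLineDerivAt ℝ (fun p : ι → ℝ => ∑ i, f i (p i))
      (∑ i, f' i (y i) * (x i - y i)) y (x - y) :=
  hasLineDerivAt_separable fun i => (hf y hy i).imp_right fun h => sub_eq_zero.2 (h x hx)

lemma HasCoordDerivOn.continuousOn (hf : HasCoordDerivOn f f' s) :
    ContinuousOn (fun p : ι → ℝ => ∑ i, f i (p i)) s := by
  refine continuousOn_finsetSum _ fun i _ p hp => ?_
  rcases hf p hp i with hderiv | hconst
  · exact (ContinuousAt.comp (f := fun q : ι → ℝ => q i) hderiv.continuousAt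
      (continuous_apply i).continuousAt).continuousWithinAt
  · exact (continuousWithinAt_const (b := f i (p i))).congr
      (fun q hq => by rw [hconst q hq]) rfl

lemma HasCoordDerivOn.bregman_eq (hf : HasCoordDerivOn f f' s) {x y : ι → ℝ} (hx : x ∈ s)
    (hy : y ∈ s) :
    bregman (fun p : ι → ℝ => ∑ i, f i (p i)) x y = separableDiv f f' x y := by
  simp only [bregman, separableDiv, (hf.hasLineDerivAt hx hy).lineDeriv, sum_sub_distrib]

lemma HasCoordDerivOn.argminOn_spec (hf : HasCoordDerivOn f f' s) (hs : Convex ℝ s)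
    (hc : IsCompact s) (hne : s.Nonempty) {F : (ι → ℝ) → ℝ}
    (hF : ∀ p ∈ s, F p = ∑ i, f i (p i)) :
    argminOn s F ∈ s ∧
      ∀ u ∈ s, 0 ≤ ∑ i, f' i (argminOn s F i) * (u i - argminOn s F i) := by
  obtain ⟨hmem, hmin⟩ := GraphBandit.argminOn_spec
    (hc.exists_isMinOn hne (hf.continuousOn.congr hF))
  refine ⟨hmem, fun u hu => lineDeriv_nonneg_of_isMinOn hs hmem hu (fun q hq => ?_)
    (hf.hasLineDerivAt hu hmem)⟩
  have hle : F (argminOn s F) ≤ F q := hmin hq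
  rwa [hF _ hmem, hF _ hq] at hle

lemma HasCoordDerivOn.omdStep_spec (hf : HasCoordDerivOn f f' s) (hs : Convex ℝ s)
    (hc : IsCompact s) {ψ : (ι → ℝ) → ℝ} (hψ : ∀ p, ψ p = ∑ i, f i (p i)) (g : ι → ℝ)
    {q : ι → ℝ} (hq : q ∈ s) :
    omdStep s ψ g q ∈ s ∧ ∀ u ∈ s, omdStep s ψ g q ⬝ᵥ g - u ⬝ᵥ g ≤
      separableDiv f f' u q - separableDiv f f' u (omdStep s ψ g q)
        - separableDiv f f' (omdStep s ψ g q) q := by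
  obtain rfl : ψ = fun p => ∑ i, f i (p i) := funext hψ
  obtain ⟨hmem, hopt⟩ := (hf.omdObjective g q).argminOn_spec hs hc ⟨q, hq⟩
    (F := fun p => p ⬝ᵥ g + bregman (fun p => ∑ i, f i (p i)) p q) fun p hp => by
      rw [hf.bregman_eq hp hq, separableDiv, dotProduct, ← sum_add_distrib]
  refine ⟨hmem, fun u hu => le_of_sub_nonneg ((hopt u hu).trans_eq ?_)⟩
  rw [separableDiv_three_point, dotProduct, dotProduct, ← sum_sub_distrib, ← sum_sub_distrib]
  exact sum_congr rfl fun i _ => by simp only [omdStep]; ring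

end Separable

/-! ### Hedge -/

section Hedge

variable {K T : ℕ} {C : Finset (Fin K)}

lemma convex_hedgeDomain : Convex ℝ (hedgeDomain T C) :=
  (convex_stdSimplex ℝ _).inter <|
    (convex_pi (s := (C : Set (Fin K))) fun _ _ => convex_Ici (1 / ((#C : ℝ) * T))).inter
      (convex_pi (s := (C : Set (Fin K))ᶜ) fun _ _ => convex_singleton (0 : ℝ))

lemma isCompact_hedgeDomain : IsCompact (hedgeDomain T C) :=
  (isCompact_stdSimplex ℝ _).inter_right <|
    (isClosed_set_pi (i := (C : Set (Fin K))) (s := fun _ => Set.Ici (1 / ((#C : ℝ) * T)))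
      fun _ _ => isClosed_Ici).inter
      (isClosed_set_pi (i := (C : Set (Fin K))ᶜ) (s := fun _ => {(0 : ℝ)})
        fun _ _ => isClosed_singleton)

lemma pos_of_mem_hedgeDomain (hT : 0 < T) {p : Fin K → ℝ} (hp : p ∈ hedgeDomain T C)
    {i : Fin K} (hi : i ∈ C) : 0 < p i := by
  have : 0 < #C := card_pos.2 ⟨i, hi⟩
  exact lt_of_lt_of_le (by positivity) (hp.2.1 i hi)

lemma neg_log_le_of_mem_hedgeDomain (hT : 0 < T) {p : Fin K → ℝ} (hp : p ∈ hedgeDomain T C)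
    {i : Fin K} (hi : i ∈ C) : -log (p i) ≤ log (K * T) := by
  have hC : 0 < #C := card_pos.2 ⟨i, hi⟩
  have hCK : #C ≤ K := (card_le_univ C).trans_eq (Fintype.card_fin K)
  have hlog := log_le_log (by positivity) (hp.2.1 i hi)
  rw [one_div, log_inv] at hlog
  calc -log (p i) ≤ log (#C * T) := by linarith
    _ ≤ log (K * T) := by gcongr

lemma hedgeInit_mem (hT : 0 < T) (hC : C.Nonempty) :
    (hedgeInit C).prob ∈ hedgeDomain T C := by
  have hcard : (0 : ℝ) < #C := by exact_mod_cast card_pos.2 hC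
  refine ⟨⟨fun i => ?_, ?_⟩, fun i hi => ?_, fun i hi => ?_⟩
  · simp only [hedgeInit]
    split_ifs <;> positivity
  · simp [hedgeInit, hcard.ne']
  · simp only [hedgeInit, hi, if_true]
    exact one_div_le_one_div_of_le hcard (le_mul_of_one_le_right hcard.le (by exact_mod_cast hT))
  · simp [hedgeInit, hi]

/-- The relative entropy of `u` with respect to `p`. -/
def entropyDiv {ι : Type*} [Fintype ι] (u p : ι → ℝ) : ℝ := ∑ i, p i * klFun (u i / p i)

lemma mul_klFun_div {u p : ℝ} (hu : 0 < u) (hp : 0 < p) :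
    p * klFun (u / p) = u * (log u - log p) + p - u := by
  rw [klFun_apply, log_div hu.ne' hp.ne']
  field_simp

lemma entropyDiv_nonneg {ι : Type*} [Fintype ι] {u p : ι → ℝ} (hu : ∀ i, 0 ≤ u i)
    (hp : ∀ i, 0 ≤ p i) : 0 ≤ entropyDiv u p :=
  sum_nonneg fun i _ => mul_nonneg (hp i) (klFun_nonneg (div_nonneg (hu i) (hp i)))

lemma entropyDiv_le_log (hT : 0 < T) {u p : Fin K → ℝ} (hu : u ∈ hedgeDomain T C)
    (hp : p ∈ hedgeDomain T C) : entropyDiv u p ≤ log (K * T) := by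
  have hterm : ∀ i, p i * klFun (u i / p i) ≤ u i * log (K * T) + p i - u i := by
    intro i
    by_cases hi : i ∈ C
    · have hui := pos_of_mem_hedgeDomain hT hu hi
      have hlog_u : log (u i) ≤ 0 := log_nonpos hui.le
        (hu.1.2 ▸ single_le_sum (fun j _ => hu.1.1 j) (mem_univ i))
      rw [mul_klFun_div hui (pos_of_mem_hedgeDomain hT hp hi)]
      gcongr
      linarith [neg_log_le_of_mem_hedgeDomain hT hp hi]
    · simp [hu.2.2 i hi, hp.2.2 i hi]
  calc entropyDiv u p ≤ ∑ i, (u i * log (K * T) + p i - u i) := sum_le_sum fun i _ => hterm i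
    _ = log (K * T) := by
      rw [sum_sub_distrib, sum_add_distrib, ← sum_mul, hu.1.2, hp.1.2]
      ring

lemma hasCoordDerivOn_entropy (hT : 0 < T) (η : ℝ) :
    HasCoordDerivOn (fun _ t => 1 / η * (t * log t)) (fun _ t => 1 / η * (log t + 1))
      (hedgeDomain T C) := by
  intro p hp i
  by_cases hi : i ∈ C
  · exact .inl ((hasDerivAt_mul_log (pos_of_mem_hedgeDomain hT hp hi).ne').const_mul _)
  · exact .inr fun q hq => by rw [hq.2.2 i hi, hp.2.2 i hi]

lemma separableDiv_entropy (hT : 0 < T) (η : ℝ) {u p : Fin K → ℝ} (hu : u ∈ hedgeDomain T C)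
    (hp : p ∈ hedgeDomain T C) :
    separableDiv (fun _ t => 1 / η * (t * log t)) (fun _ t => 1 / η * (log t + 1)) u p
      = 1 / η * entropyDiv u p := by
  rw [separableDiv, entropyDiv, mul_sum]
  refine sum_congr rfl fun i _ => ?_
  by_cases hi : i ∈ C
  · rw [mul_klFun_div (pos_of_mem_hedgeDomain hT hu hi) (pos_of_mem_hedgeDomain hT hp hi)]
    ring
  · simp [hp.2.2 i hi, hu.2.2 i hi]

lemma dotProduct_sub_entropyDiv_le {η : ℝ} (hT : 0 < T) (hη : 0 < η) {p p' g : Fin K → ℝ}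
    (hp : p ∈ hedgeDomain T C) (hp' : p' ∈ hedgeDomain T C) (hg : ∀ i, 0 ≤ g i) :
    p ⬝ᵥ g - p' ⬝ᵥ g - 1 / η * entropyDiv p' p ≤ 2 * η * ∑ i, p i * g i ^ 2 := by
  rw [dotProduct, dotProduct, entropyDiv, mul_sum, mul_sum, ← sum_sub_distrib, ← sum_sub_distrib]
  refine sum_le_sum fun i _ => ?_
  by_cases hi : i ∈ C
  · have hpi := pos_of_mem_hedgeDomain hT hp hi
    have hstab := entropy_stability hη hpi (hg i)
      (div_pos (pos_of_mem_hedgeDomain hT hp' hi) hpi)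
    rwa [show p i * g i * (1 - p' i / p i) = p i * g i - p' i * g i by field_simp] at hstab
  · simp [hp.2.2 i hi, hp'.2.2 i hi]

lemma hedge_omdStep {η : ℝ} (hT : 0 < T) (hη : 0 < η) {p g : Fin K → ℝ}
    (hp : p ∈ hedgeDomain T C) (hg : ∀ i, 0 ≤ g i) :
    omdStep (hedgeDomain T C) (entropyReg η) g p ∈ hedgeDomain T C ∧
      ∀ u ∈ hedgeDomain T C, p ⬝ᵥ g - u ⬝ᵥ g ≤
        1 / η * (entropyDiv u p
          - entropyDiv u (omdStep (hedgeDomain T C) (entropyReg η) g p))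
        + 2 * η * ∑ i, p i * g i ^ 2 := by
  obtain ⟨hmem, hstep⟩ := (hasCoordDerivOn_entropy (C := C) hT η).omdStep_spec
    convex_hedgeDomain isCompact_hedgeDomain (ψ := entropyReg η) (fun _ => mul_sum ..) g hp
  refine ⟨hmem, fun u hu => ?_⟩
  have hle := hstep u hu
  rw [separableDiv_entropy hT η hu hp, separableDiv_entropy hT η hu hmem,
    separableDiv_entropy hT η hmem hp] at hle
  linarith [dotProduct_sub_entropyDiv_le hT hη hp hmem hg]

/-- The state of a Hedge instance is admissible: it proposes a point of its decision set. -/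
structure HedgeState.Valid (T : ℕ) (C : Finset (Fin K)) (h : HedgeState K) : Prop where
  prob_mem : h.prob ∈ hedgeDomain T C
  sqSum_nonneg : 0 ≤ h.sqSum

lemma hedgeInit_valid (hT : 0 < T) (hC : C.Nonempty) : (hedgeInit C).Valid T C :=
  ⟨hedgeInit_mem hT hC, le_rfl⟩

lemma HedgeState.Valid.hedgeStep (hT : 0 < T) {h : HedgeState K} (hh : h.Valid T C)
    {g : Fin K → ℝ} (hg : ∀ i, 0 ≤ g i) : (hedgeStep T C h g).Valid T C := by
  have hsum : 0 ≤ h.sqSum + ∑ i, h.prob i * g i ^ 2 := add_nonneg hh.sqSum_nonneg <|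
    sum_nonneg fun i _ => mul_nonneg (hh.prob_mem.1.1 i) (sq_nonneg _)
  exact ⟨(hedge_omdStep hT (sqrt_pos.2 (by positivity)) hh.prob_mem hg).1, hsum⟩

/-- A potential bound for a Hedge instance compared to the fixed distribution `u`: here `X` is the
loss of the instance so far, and `U` is the loss of `u`. -/
def HedgeBound (T : ℕ) (u : Fin K → ℝ) (h : HedgeState K) (X U : ℝ) : Prop :=
  X - U + √(1 + h.sqSum) * entropyDiv u h.prob ≤ (log (K * T) + 4) * √(1 + h.sqSum)

lemma HedgeBound.mono {u : Fin K → ℝ} {h : HedgeState K} {X U U' : ℝ} (hb : HedgeBound T u h X U)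
    (hU : U ≤ U') : HedgeBound T u h X U' := by
  unfold HedgeBound at hb ⊢
  linarith

lemma hedgeBound_init (hT : 0 < T) (hC : C.Nonempty) {u : Fin K → ℝ}
    (hu : u ∈ hedgeDomain T C) : HedgeBound T u (hedgeInit C) 0 0 := by
  have hdiv := entropyDiv_le_log hT hu (hedgeInit_mem hT hC)
  simp only [HedgeBound, hedgeInit, add_zero, sqrt_one, one_mul, mul_one, sub_zero,
    zero_add] at hdiv ⊢
  linarith

lemma HedgeBound.hedgeStep (hT : 0 < T) {u g : Fin K → ℝ} {h : HedgeState K} {X U : ℝ}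
    (hu : u ∈ hedgeDomain T C) (hh : h.Valid T C) (hg : ∀ i, 0 ≤ g i) (hb : HedgeBound T u h X U) :
    HedgeBound T u (hedgeStep T C h g) (X + h.prob ⬝ᵥ g) (U + u ⬝ᵥ g) := by
  set v := ∑ i, h.prob i * g i ^ 2 with hv
  have hv0 : 0 ≤ v := sum_nonneg fun i _ => mul_nonneg (hh.prob_mem.1.1 i) (sq_nonneg _)
  have hV := hh.sqSum_nonneg
  have hpos : 0 < 1 + (h.sqSum + v) := by linarith
  have hstep := (hedge_omdStep hT (sqrt_pos.2 (one_div_pos.2 hpos)) hh.prob_mem hg).2 u hu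
  rw [← hv, show 2 * √(1 / (1 + (h.sqSum + v))) * v = 2 * (v / √(1 + (h.sqSum + v))) by
      rw [one_div, sqrt_inv]; ring,
    show 1 / √(1 / (1 + (h.sqSum + v))) = √(1 + (h.sqSum + v)) by
      rw [one_div, one_div, sqrt_inv, inv_inv]] at hstep
  have hgrowth : (√(1 + (h.sqSum + v)) - √(1 + h.sqSum)) * entropyDiv u h.prob ≤
      (√(1 + (h.sqSum + v)) - √(1 + h.sqSum)) * log (K * T) :=
    mul_le_mul_of_nonneg_left (entropyDiv_le_log hT hu hh.prob_mem)
      (sub_nonneg.2 (sqrt_le_sqrt (by linarith)))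
  simp only [HedgeBound, GraphBandit.hedgeStep, ← hv] at hb ⊢
  linarith [div_sqrt_one_add_le hV hv0]

lemma HedgeBound.sub_le {u : Fin K → ℝ} {h : HedgeState K} {X U : ℝ}
    (hu : ∀ i, 0 ≤ u i) (hh : h.Valid T C) (hb : HedgeBound T u h X U) :
    X - U ≤ (log (K * T) + 4) * √(1 + h.sqSum) := by
  have := mul_nonneg (sqrt_nonneg (1 + h.sqSum)) (entropyDiv_nonneg hu hh.prob_mem.1.1)
  unfold HedgeBound at hb
  linarith

end Hedge

/-! ### Mirror descent over the meta-nodes -/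

section Meta

variable {K κ T : ℕ} {G : Digraph (Fin K)} {c η : ℝ} {rate : Fin κ → ℝ} {u p p' g : Meta G κ → ℝ}

lemma convex_metaDomain : Convex ℝ (metaDomain T G κ) :=
  (convex_stdSimplex ℝ _).inter (convex_Ici fun _ => 1 / (T : ℝ))

lemma isCompact_metaDomain : IsCompact (metaDomain T G κ) :=
  (isCompact_stdSimplex ℝ _).inter_right (isClosed_Ici (a := fun _ => 1 / (T : ℝ)))

lemma pos_of_mem_metaDomain (hT : 0 < T) (hp : p ∈ metaDomain T G κ) (m : Meta G κ) : 0 < p m :=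
  lt_of_lt_of_le (by positivity) (hp.2 m)

lemma log_nonpos_of_mem_metaDomain (hp : p ∈ metaDomain T G κ) (m : Meta G κ) :
    log (p m) ≤ 0 :=
  log_nonpos (hp.1.1 m) (hp.1.2 ▸ single_le_sum (fun j _ => hp.1.1 j) (mem_univ m))

lemma neg_log_le_of_mem_metaDomain (hT : 0 < T) (hp : p ∈ metaDomain T G κ) (m : Meta G κ) :
    -log (p m) ≤ log T := by
  have hlog := log_le_log (by positivity) (hp.2 m)
  rw [one_div, log_inv] at hlog
  linarith

/-- The summand of the hybrid regularizer at one meta-node. -/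
def hybridFun (c η : ℝ) (rate : Fin κ → ℝ) : Meta G κ → ℝ → ℝ
  | .inl j, t => 1 / rate j * -log t
  | .inr _, t => 1 / η * (t * log t) + c * -log t

/-- The derivative of `hybridFun`. -/
def hybridFun' (c η : ℝ) (rate : Fin κ → ℝ) : Meta G κ → ℝ → ℝ
  | .inl j, t => 1 / rate j * -t⁻¹
  | .inr _, t => 1 / η * (log t + 1) + c * -t⁻¹

/-- The contribution of one meta-node to the divergence `hybridDiv`. -/
def hybridCoordDiv (c η : ℝ) (rate : Fin κ → ℝ) : Meta G κ → ℝ → ℝ → ℝ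
  | .inl j, x, y => 1 / rate j * barrierGap (x / y)
  | .inr _, x, y => 1 / η * (y * klFun (x / y)) + c * barrierGap (x / y)

/-- The Bregman divergence of the hybrid regularizer. -/
def hybridDiv (c η : ℝ) (rate : Fin κ → ℝ) (u p : Meta G κ → ℝ) : ℝ :=
  ∑ m, hybridCoordDiv c η rate m (u m) (p m)

lemma hasCoordDerivOn_hybridFun (hT : 0 < T) :
    HasCoordDerivOn (hybridFun c η rate) (hybridFun' c η rate) (metaDomain T G κ) := by
  intro p hp m
  have hpm := (pos_of_mem_metaDomain hT hp m).ne'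
  have hbarrier := (hasDerivAt_log hpm).neg
  refine .inl ?_
  rcases m with j | v
  · exact hbarrier.const_mul _
  · exact ((hasDerivAt_mul_log hpm).const_mul _).add (hbarrier.const_mul _)

lemma hybridReg_eq_sum (p : Meta G κ → ℝ) :
    hybridReg c η rate p = ∑ m, hybridFun c η rate m (p m) := by
  simp [hybridReg, hybridFun, Fintype.sum_sum_type, sum_add_distrib, mul_sum, add_assoc]

lemma separableDiv_hybridFun (hu : ∀ m, 0 < u m) (hp : ∀ m, 0 < p m) :
    separableDiv (hybridFun c η rate) (hybridFun' c η rate) u p = hybridDiv c η rate u p := by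
  refine sum_congr rfl fun m _ => ?_
  have hum := hu m
  have hpm := hp m
  rcases m with j | v
  · simp only [hybridFun, hybridFun', hybridCoordDiv, barrierGap]
    rw [log_div hum.ne' hpm.ne']
    field_simp
    ring
  · simp only [hybridFun, hybridFun', hybridCoordDiv, barrierGap, mul_klFun_div hum hpm]
    rw [log_div hum.ne' hpm.ne']
    field_simp
    ring

lemma hybridCoordDiv_nonneg (hη : 0 < η) (hc : 0 ≤ c) (hr : ∀ j, 0 < rate j) (m : Meta G κ)
    {x y : ℝ} (hx : 0 < x) (hy : 0 < y) : 0 ≤ hybridCoordDiv c η rate m x y := by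
  have hbarrier := barrierGap_nonneg (div_pos hx hy)
  have hentropy := klFun_nonneg (div_pos hx hy).le
  rcases m with j | v
  · have := hr j
    simp only [hybridCoordDiv]
    positivity
  · simp only [hybridCoordDiv]
    positivity

lemma hybridCoordDiv_le_hybridDiv (hη : 0 < η) (hc : 0 ≤ c) (hr : ∀ j, 0 < rate j)
    (hu : ∀ m, 0 < u m) (hp : ∀ m, 0 < p m) (m : Meta G κ) :
    hybridCoordDiv c η rate m (u m) (p m) ≤ hybridDiv c η rate u p :=
  single_le_sum (f := fun m => hybridCoordDiv c η rate m (u m) (p m))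
    (fun m _ => hybridCoordDiv_nonneg hη hc hr m (hu m) (hp m)) (mem_univ m)

/-- The loss vector `g` is nonnegative and no larger than an importance-weighted estimator whose
sampling distribution is `p`. -/
structure LossBound (p g : Meta G κ → ℝ) : Prop where
  nonneg : ∀ m, 0 ≤ g m
  clique : ∀ j, p (.inl j) * g (.inl j) ≤ 1
  noLoop : ∀ v, (1 - p (.inr v)) * g (.inr v) ≤ 1

lemma LossBound.noLoop_le_two (hg : LossBound p g) {v : NoLoop G} (hv : p (.inr v) ≤ 1 / 2) :
    g (.inr v) ≤ 2 := by
  nlinarith [hg.noLoop v, hg.nonneg (.inr v)]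

lemma clique_stability {r p g s x : ℝ} (hη : 10 * η ≤ 1) (hr : 0 < r) (hr5 : r ≤ 5 * η)
    (hp : 0 < p) (hg : 0 ≤ g) (hpg : p * g ≤ 1) (hs : 0 ≤ s) (hps : p * s ≤ 1) (hx : 0 < x) :
    (g - s) * (p - x) - 1 / r * barrierGap (x / p) ≤ 10 * η * (p * g + p * s) := by
  have hpg0 : 0 ≤ p * g := by positivity
  have hps0 : 0 ≤ p * s := by positivity
  have hsq : (p * (g - s)) ^ 2 ≤ p * g + p * s := by nlinarith
  calc (g - s) * (p - x) - 1 / r * barrierGap (x / p)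
      = p * (g - s) * (1 - x / p) - 1 / r * barrierGap (x / p) := by field_simp
    _ ≤ 2 * r * (p * (g - s)) ^ 2 := barrier_stability hr (by nlinarith) (div_pos hx hp)
    _ ≤ 2 * (5 * η) * (p * g + p * s) := by gcongr; linarith
    _ = 10 * η * (p * g + p * s) := by ring

lemma noLoop_stability {p g s x : ℝ} (hη : 0 < η) (hc : 4 ≤ c) (hp : 0 < p) (hg : 0 ≤ g)
    (hg2 : g ≤ 2) (hs : 0 ≤ s) (hps : p * s ≤ 1) (hx : 0 < x) :
    (g - s) * (p - x) - (1 / η * (p * klFun (x / p)) + c * barrierGap (x / p))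
      ≤ 10 * η * (p * g + p * s ^ 2) := by
  have hsq : (g - s) ^ 2 ≤ 5 * (g + s ^ 2) := by nlinarith
  calc (g - s) * (p - x) - (1 / η * (p * klFun (x / p)) + c * barrierGap (x / p))
      = p * (g - s) * (1 - x / p)
        - (1 / η * (p * klFun (x / p)) + c * barrierGap (x / p)) := by field_simp
    _ ≤ 2 * η * (p * (g - s) ^ 2) :=
      hybrid_stability hη hc hp (by nlinarith) (div_pos hx hp)
    _ ≤ 2 * η * (p * (5 * (g + s ^ 2))) := by gcongr
    _ = 10 * η * (p * g + p * s ^ 2) := by ring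

lemma hybridCoord_stability (hη : 0 < η) (hη10 : 10 * η ≤ 1) (hc : 4 ≤ c)
    (hr : ∀ j, 0 < rate j) (hr5 : ∀ j, rate j ≤ 5 * η) (hg : LossBound p g) {m : Meta G κ}
    (hp : 0 < p m) (hp' : 0 < p' m) (hhalf : ∀ v, m = .inr v → p m ≤ 1 / 2) {s : ℝ} (hs : 0 ≤ s)
    (hps : p m * s ≤ 1) :
    (g m - s) * (p m - p' m) - hybridCoordDiv c η rate m (p' m) (p m)
      ≤ 10 * η * (p m * g m + p m * s + p m * s ^ 2) := by
  rcases m with j | v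
  · have hstab := clique_stability hη10 (hr j) (hr5 j) hp (hg.nonneg _) (hg.clique j) hs hps hp'
    have hrest : 0 ≤ 10 * η * (p (.inl j) * s ^ 2) := by positivity
    simp only [hybridCoordDiv]
    linarith
  · have hstab := noLoop_stability hη hc hp (hg.nonneg _) (hg.noLoop_le_two (hhalf v rfl)) hs hps
      hp'
    have hrest : 0 ≤ 10 * η * (p (.inr v) * s) := by positivity
    simp only [hybridCoordDiv]
    linarith

lemma dotProduct_sub_dotProduct_shift {ι : Type*} [Fintype ι] {p p' : ι → ℝ} (g : ι → ℝ)
    (h : ∑ i, p i = ∑ i, p' i) (s : ℝ) :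
    p ⬝ᵥ g - p' ⬝ᵥ g = ∑ i, (g i - s) * (p i - p' i) := by
  have hshift : ∑ i, s * (p i - p' i) = 0 := by
    rw [← mul_sum, sum_sub_distrib, h, sub_self, mul_zero]
  rw [← sub_zero (p ⬝ᵥ g - p' ⬝ᵥ g), ← hshift, dotProduct, dotProduct]
  simp only [← sum_sub_distrib]
  exact sum_congr rfl fun i _ => by ring

section Stability

variable (hη : 0 < η) (hη10 : 10 * η ≤ 1) (hc : 4 ≤ c) (hr : ∀ j, 0 < rate j)
  (hr5 : ∀ j, rate j ≤ 5 * η) (hp : ∀ m, 0 < p m) (hp1 : ∑ m, p m = 1) (hp' : ∀ m, 0 < p' m)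
  (hp1' : ∑ m, p' m = 1) (hg : LossBound p g)
include hη hη10 hc hr hr5 hp hp1 hp' hp1' hg

lemma hybrid_omd_stability_of_le_half (hhalf : ∀ v, p (.inr v) ≤ 1 / 2) :
    p ⬝ᵥ g - p' ⬝ᵥ g - hybridDiv c η rate p' p ≤ 10 * η * (p ⬝ᵥ g) := by
  rw [dotProduct_sub_dotProduct_shift g (hp1.trans hp1'.symm) 0, hybridDiv, ← sum_sub_distrib,
    dotProduct, mul_sum]
  refine sum_le_sum fun m _ => ?_
  have hstab := hybridCoord_stability (s := 0) hη hη10 hc hr hr5 hg (hp m) (hp' m)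
    (fun v hv => hv ▸ hhalf v) le_rfl (by simp)
  simpa using hstab

/-- Subtracting the loss of the heavy meta-node `v` from all the losses removes its contribution,
and the other meta-nodes share a mass so small that the shift does not hurt them. -/
lemma hybrid_omd_stability_of_half_lt {v : NoLoop G} (hv : 1 / 2 < p (.inr v)) :
    p ⬝ᵥ g - p' ⬝ᵥ g - hybridDiv c η rate p' p ≤ 40 * η * (p ⬝ᵥ g) := by
  classical
  set s := g (.inr v)
  set q := p (.inr v)
  set others := univ.erase (Sum.inr v : Meta G κ)
  have hs0 : 0 ≤ s := hg.nonneg _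
  have hs1 : (1 - q) * s ≤ 1 := hg.noLoop v
  have hmass : ∑ m ∈ others, p m = 1 - q := by
    rw [← hp1, ← add_sum_erase univ p (mem_univ (Sum.inr v : Meta G κ))]
    ring
  have hloss : p ⬝ᵥ g = q * s + ∑ m ∈ others, p m * g m :=
    (add_sum_erase univ (fun m => p m * g m) (mem_univ (Sum.inr v : Meta G κ))).symm
  have hothers : ∑ m ∈ others, ((g m - s) * (p m - p' m) - hybridCoordDiv c η rate m (p' m) (p m))
      ≤ 10 * η * (∑ m ∈ others, p m * g m + (1 - q) * s + (1 - q) * s ^ 2) := by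
    rw [← hmass, sum_mul, sum_mul, ← sum_add_distrib, ← sum_add_distrib, mul_sum]
    refine sum_le_sum fun m hm => ?_
    have hle : p m ≤ 1 - q := hmass ▸ single_le_sum (fun i _ => (hp i).le) hm
    exact hybridCoord_stability hη hη10 hc hr hr5 hg (hp m) (hp' m) (fun _ _ => by linarith) hs0
      ((mul_le_mul_of_nonneg_right hle hs0).trans hs1)
  have hdiv0 : 0 ≤ hybridCoordDiv c η rate (.inr v) (p' (.inr v)) q :=
    hybridCoordDiv_nonneg hη (by linarith) hr _ (hp' _) (hp _)
  have hothers0 : 0 ≤ ∑ m ∈ others, p m * g m :=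
    sum_nonneg fun m _ => mul_nonneg (hp m).le (hg.nonneg m)
  have hlin : (1 - q) * s ≤ q * s := by gcongr; linarith
  have hsq : (1 - q) * s ^ 2 ≤ 2 * (q * s) := by nlinarith
  calc p ⬝ᵥ g - p' ⬝ᵥ g - hybridDiv c η rate p' p
      ≤ ∑ m ∈ others, ((g m - s) * (p m - p' m) - hybridCoordDiv c η rate m (p' m) (p m)) := by
        rw [dotProduct_sub_dotProduct_shift g (hp1.trans hp1'.symm) s, hybridDiv, ← sum_sub_distrib,
          ← add_sum_erase univ _ (mem_univ (Sum.inr v : Meta G κ))]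
        linarith
    _ ≤ 10 * η * (∑ m ∈ others, p m * g m + (1 - q) * s + (1 - q) * s ^ 2) := hothers
    _ ≤ 10 * η * (4 * (p ⬝ᵥ g)) := by gcongr; linarith
    _ = 40 * η * (p ⬝ᵥ g) := by ring

lemma hybrid_omd_stability :
    p ⬝ᵥ g - p' ⬝ᵥ g - hybridDiv c η rate p' p ≤ 40 * η * (p ⬝ᵥ g) := by
  by_cases hhalf : ∀ v : NoLoop G, p (.inr v) ≤ 1 / 2
  · have hloss : 0 ≤ p ⬝ᵥ g := sum_nonneg fun m _ => mul_nonneg (hp m).le (hg.nonneg m)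
    refine (hybrid_omd_stability_of_le_half hη hη10 hc hr hr5 hp hp1 hp' hp1' hg hhalf).trans ?_
    gcongr
    norm_num
  · push Not at hhalf
    obtain ⟨v, hv⟩ := hhalf
    exact hybrid_omd_stability_of_half_lt hη hη10 hc hr hr5 hp hp1 hp' hp1' hg hv

end Stability

lemma hybrid_omdStep (hT : 0 < T) (hη : 0 < η) (hη10 : 10 * η ≤ 1) (hc : 4 ≤ c)
    (hr : ∀ j, 0 < rate j) (hr5 : ∀ j, rate j ≤ 5 * η) (hp : p ∈ metaDomain T G κ)
    (hg : LossBound p g) :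
    omdStep (metaDomain T G κ) (hybridReg c η rate) g p ∈ metaDomain T G κ ∧
      ∀ u ∈ metaDomain T G κ, p ⬝ᵥ g - u ⬝ᵥ g ≤ hybridDiv c η rate u p
        - hybridDiv c η rate u (omdStep (metaDomain T G κ) (hybridReg c η rate) g p)
        + 40 * η * (p ⬝ᵥ g) := by
  obtain ⟨hmem, hstep⟩ := (hasCoordDerivOn_hybridFun hT).omdStep_spec convex_metaDomain
    isCompact_metaDomain hybridReg_eq_sum g hp
  have hpos : ∀ q ∈ metaDomain T G κ, ∀ m, 0 < q m := fun q hq => pos_of_mem_metaDomain hT hq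
  refine ⟨hmem, fun u hu => ?_⟩
  have hle := hstep u hu
  rw [separableDiv_hybridFun (hpos u hu) (hpos p hp),
    separableDiv_hybridFun (hpos u hu) (hpos _ hmem),
    separableDiv_hybridFun (hpos _ hmem) (hpos p hp)] at hle
  linarith [hybrid_omd_stability hη hη10 hc hr hr5 (hpos p hp) hp.1.2 (hpos _ hmem) hmem.1.2 hg]

lemma hybridFun_inl_sub_le (hT : 0 < T) (hη : 0 < η) (hu : u ∈ metaDomain T G κ)
    (hp : p ∈ metaDomain T G κ) (j : Fin κ) :
    hybridFun (G := G) c η (fun _ => η) (.inl j) (u (.inl j))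
      - hybridFun (G := G) c η (fun _ => η) (.inl j) (p (.inl j)) ≤ 1 / η * log T := by
  simp only [hybridFun, ← mul_sub]
  gcongr
  linarith [neg_log_le_of_mem_metaDomain hT hu (.inl j), log_nonpos_of_mem_metaDomain hp (.inl j)]

lemma hybridFun_inr_sub_le (hT : 0 < T) (hη : 0 < η) (hc : 0 ≤ c) (hu : u ∈ metaDomain T G κ)
    (hp : p ∈ metaDomain T G κ) (v : NoLoop G) :
    hybridFun c η rate (.inr v) (u (.inr v)) - hybridFun c η rate (.inr v) (p (.inr v))
      ≤ 1 / η * (p (.inr v) * log T) + c * log T := by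
  have hlog_u := log_nonpos_of_mem_metaDomain hu (.inr v)
  have hlog_p := log_nonpos_of_mem_metaDomain hp (.inr v)
  have hentropy_u : 1 / η * (u (.inr v) * log (u (.inr v))) ≤ 0 :=
    mul_nonpos_of_nonneg_of_nonpos (by positivity)
      (mul_nonpos_of_nonneg_of_nonpos (hu.1.1 _) hlog_u)
  have hentropy_p : 1 / η * (p (.inr v) * -log (p (.inr v))) ≤ 1 / η * (p (.inr v) * log T) := by
    have := hp.1.1 (.inr v)
    gcongr
    exact neg_log_le_of_mem_metaDomain hT hp _
  have hbarrier : c * (-log (u (.inr v)) + log (p (.inr v))) ≤ c * log T := by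
    gcongr
    linarith [neg_log_le_of_mem_metaDomain hT hu (.inr v)]
  simp only [hybridFun]
  linarith

lemma card_noLoop_le_metaCard : Fintype.card (NoLoop G) ≤ metaCard G κ := by
  rw [metaCard, Fintype.card_sum]
  exact Nat.le_add_left _ _

lemma sum_hybridFun_sub_le (hT : 0 < T) (hη : 0 < η) (hc : 0 ≤ c) (hu : u ∈ metaDomain T G κ)
    (hp : p ∈ metaDomain T G κ) :
    ∑ m, (hybridFun c η (fun _ => η) m (u m) - hybridFun c η (fun _ => η) m (p m))
      ≤ ((κ + 1) / η + c * metaCard G κ) * log T := by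
  have := log_natCast_nonneg T
  have hmass : ∑ v : NoLoop G, p (.inr v) ≤ 1 := by
    have hsum := hp.1.2
    rw [Fintype.sum_sum_type] at hsum
    linarith [sum_nonneg fun (j : Fin κ) (_ : j ∈ univ) => hp.1.1 (.inl j)]
  rw [Fintype.sum_sum_type]
  calc _ ≤ ∑ _j : Fin κ, 1 / η * log T
        + ∑ v : NoLoop G, (1 / η * (p (.inr v) * log T) + c * log T) :=
        add_le_add (sum_le_sum fun j _ => hybridFun_inl_sub_le hT hη hu hp j)
          (sum_le_sum fun v _ => hybridFun_inr_sub_le hT hη hc hu hp v)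
    _ = κ * (1 / η * log T) + (1 / η * ((∑ v : NoLoop G, p (.inr v)) * log T)
        + Fintype.card (NoLoop G) * (c * log T)) := by
        simp only [sum_add_distrib, ← mul_sum, ← sum_mul, sum_const, card_univ, Fintype.card_fin,
          nsmul_eq_mul]
        ring
    _ ≤ κ * (1 / η * log T) + (1 / η * (1 * log T) + metaCard G κ * (c * log T)) := by
        gcongr
        exact card_noLoop_le_metaCard
    _ = ((κ + 1) / η + c * metaCard G κ) * log T := by ring

lemma restart_div_le (hT : 0 < T) (hη : 0 < η) (hc : 0 ≤ c) (hne : (metaDomain T G κ).Nonempty) :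
    argminOn (metaDomain T G κ) (hybridReg c η fun _ => η) ∈ metaDomain T G κ ∧
      ∀ u ∈ metaDomain T G κ, hybridDiv c η (fun _ => η) u
        (argminOn (metaDomain T G κ) (hybridReg c η fun _ => η))
        ≤ ((κ + 1) / η + c * metaCard G κ) * log T := by
  obtain ⟨hmem, hopt⟩ := (hasCoordDerivOn_hybridFun hT).argminOn_spec convex_metaDomain
    isCompact_metaDomain hne (F := hybridReg c η fun _ => η) fun p _ => hybridReg_eq_sum p
  refine ⟨hmem, fun u hu => ?_⟩
  rw [← separableDiv_hybridFun (pos_of_mem_metaDomain hT hu) (pos_of_mem_metaDomain hT hmem),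
    separableDiv, sum_sub_distrib]
  linarith [hopt u hu, sum_hybridFun_sub_le hT hη hc hu hmem]

end Meta

/-! ### The setting -/

section

variable {K κ T : ℕ} {G : Digraph (Fin K)} {C : Fin κ → Finset (Fin K)}

lemma IsCliquePartition.eq_of_mem (hC : IsCliquePartition G C) {i : Fin K} {j j' : Fin κ}
    (hj : i ∈ C j) (hj' : i ∈ C j') : j = j' := by
  by_contra h
  exact Finset.disjoint_left.1 (hC.disjoint j j' h) hj hj'

lemma IsCliquePartition.mem_inNbrs (hC : IsCliquePartition G C) {i : Fin K} {j : Fin κ}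
    (hj : i ∈ C j) : i ∈ inNbrs G i := (hC.covers i).1 ⟨j, hj⟩

lemma IsCliquePartition.exists_meta (hC : IsCliquePartition G C) (i : Fin K) :
    ∃ m : Meta G κ, ∀ v, m = .inr v → i = v.1 := by
  by_cases hi : i ∈ inNbrs G i
  · obtain ⟨j, -⟩ := (hC.covers i).2 hi
    exact ⟨.inl j, fun v hv => by simp at hv⟩
  · exact ⟨.inr ⟨i, hi⟩, fun v hv => by simp [← Sum.inr.inj hv]⟩

lemma IsCliquePartition.metaCard_le (hC : IsCliquePartition G C) : metaCard G κ ≤ K := by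
  choose a ha using hC.nonempty
  have hne : ∀ (j : Fin κ) (v : NoLoop G), a j ≠ v.1 := fun j v h =>
    v.2 (h ▸ hC.mem_inNbrs (ha j))
  have hinj : Function.Injective (Sum.elim a Subtype.val : Meta G κ → Fin K) :=
    .sumElim (fun j j' h => hC.eq_of_mem (ha j) (h ▸ ha j')) Subtype.val_injective hne
  simpa [metaCard] using Fintype.card_le_of_injective _ hinj

lemma kappa_le_metaCard : κ ≤ metaCard G κ := by simp [metaCard]

/-- The standing assumptions on the problem. -/
structure Setting (T : ℕ) (G : Digraph (Fin K)) (C : Fin κ → Finset (Fin K)) : Prop where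
  two_le : 2 ≤ K
  two_mul_le : 2 * K ≤ T
  observable : StronglyObservable G
  partition : IsCliquePartition G C

namespace Setting

variable (hS : Setting T G C)
include hS

lemma four_le : (4 : ℝ) ≤ T := by
  have hK := hS.two_le
  have hT := hS.two_mul_le
  exact_mod_cast (by omega : 4 ≤ T)

lemma T_pos : 0 < T := by
  have hT := hS.four_le
  exact_mod_cast (by linarith : (0 : ℝ) < T)

lemma one_le_log : 1 ≤ log T := by
  rw [le_log_iff_exp_le (by exact_mod_cast hS.T_pos)]
  linarith [exp_one_lt_d9, hS.four_le]

lemma log_le_log : log T ≤ log (K * T) := by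
  have hT := hS.four_le
  have hK : (1 : ℝ) ≤ K := by exact_mod_cast one_le_two.trans hS.two_le
  gcongr
  exact le_mul_of_one_le_left (by linarith) hK

lemma two_le_log : 2 ≤ log (K * T) := by
  have hT := hS.four_le
  have hK : (2 : ℝ) ≤ K := by exact_mod_cast hS.two_le
  rw [le_log_iff_exp_le (by positivity), show (2 : ℝ) = 1 + 1 by norm_num, exp_add]
  nlinarith [exp_one_lt_d9, exp_pos 1]

lemma mul_rate_le_one {η : ℝ} (hη : 0 < η)
    (hη1 : η * (2000 * log T * log (K * T) ^ 2) ≤ 1) : 8000 * η ≤ 1 := by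
  have hlog := hS.one_le_log
  have hlogKT := hS.two_le_log
  calc 8000 * η = η * (2000 * 1 * 2 ^ 2) := by ring
    _ ≤ η * (2000 * log T * log (K * T) ^ 2) := by gcongr
    _ ≤ 1 := hη1

lemma two_mul_metaCard_le : 2 * (metaCard G κ : ℝ) ≤ T := by
  have hβ := hS.partition.metaCard_le
  have hT := hS.two_mul_le
  exact_mod_cast (by omega : 2 * metaCard G κ ≤ T)

lemma nonempty_meta : Nonempty (Meta G κ) :=
  ⟨(hS.partition.exists_meta ⟨0, by linarith [hS.two_le]⟩).choose⟩

lemma one_le_metaCard : 1 ≤ (metaCard G κ : ℝ) := by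
  have : 0 < metaCard G κ := Fintype.card_pos_iff.2 hS.nonempty_meta
  exact_mod_cast this

lemma exists_ne_noLoop (v : NoLoop G) : ∃ m : Meta G κ, m ≠ .inr v := by
  obtain ⟨⟨i, hi⟩, -⟩ := hS.observable v.1
  obtain ⟨m, hm⟩ := hS.partition.exists_meta i
  exact ⟨m, fun h => v.2 (hm v h ▸ hi)⟩

end Setting

/-! ### The comparator of the meta-algorithm -/

lemma add_le_one_of_mem_metaDomain {p : Meta G κ → ℝ} (hp : p ∈ metaDomain T G κ)
    {m m' : Meta G κ} (h : m ≠ m') : p m + p m' ≤ 1 := by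
  classical
  rw [← hp.1.2, ← sum_pair h]
  exact sum_le_sum_of_subset_of_nonneg (subset_univ _) fun i _ _ => hp.1.1 i

open Classical in
/-- The point mass at the meta-node `m`, mixed with the uniform distribution so as to lie in the
decision set. -/
def metaComparator (T : ℕ) (m m' : Meta G κ) : ℝ :=
  (if m' = m then 1 - (metaCard G κ : ℝ) / T else 0) + 1 / T

lemma metaCard_div_le (hS : Setting T G C) : (metaCard G κ : ℝ) / T ≤ 1 / 2 := by
  rw [div_le_iff₀ (by exact_mod_cast hS.T_pos)]
  linarith [hS.two_mul_metaCard_le]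

lemma metaComparator_mem (hS : Setting T G C) (m : Meta G κ) :
    metaComparator T m ∈ metaDomain T G κ := by
  have hT : (0 : ℝ) < T := by exact_mod_cast hS.T_pos
  have hβ := metaCard_div_le hS
  have hge : ∀ m', 1 / (T : ℝ) ≤ metaComparator T m m' := fun m' => by
    simp only [metaComparator]
    split_ifs <;> linarith
  refine ⟨⟨fun m' => le_trans (by positivity) (hge m'), ?_⟩, hge⟩
  simp only [metaComparator, sum_add_distrib, sum_ite_eq', mem_univ, if_true, sum_const,
    card_univ, nsmul_eq_mul, metaCard]
  ring

lemma half_le_metaComparator (hS : Setting T G C) (m : Meta G κ) :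
    1 / 2 ≤ metaComparator T m m := by
  have hT : (0 : ℝ) ≤ 1 / T := by positivity
  simp only [metaComparator, if_true]
  linarith [metaCard_div_le hS]

lemma metaComparator_dotProduct_le (m : Meta G κ) {g : Meta G κ → ℝ} (hg : ∀ m, 0 ≤ g m) :
    metaComparator T m ⬝ᵥ g ≤ g m + 1 / T * ∑ m', g m' := by
  classical
  calc metaComparator T m ⬝ᵥ g
      = (1 - (metaCard G κ : ℝ) / T) * g m + 1 / T * ∑ m', g m' := by
        simp only [metaComparator, dotProduct, add_mul, sum_add_distrib, mul_sum, ite_mul, zero_mul,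
          sum_ite_eq', mem_univ, if_true]
    _ ≤ g m + 1 / T * ∑ m', g m' := by
        gcongr
        exact mul_le_of_le_one_left (hg m) (sub_le_self _ (by positivity))

/-! ### The loss estimators -/

/-- The estimator for the meta-nodes in a round with choices `x`. -/
abbrev metaEst (C : Fin κ → Finset (Fin K)) (loss : Fin K → ℝ) (s : State G κ)
    (x : Choice G κ) : Meta G κ → ℝ :=
  metaEstimator s (armEstimator C s x (feedback G loss x.2))

section Estimators

variable {loss : Fin K → ℝ} {s : State G κ} {x : Choice G κ}

lemma feedback_mem (hl : ∀ i, loss i ∈ Set.Icc (0 : ℝ) 1) (a i : Fin K) :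
    feedback G loss a i ∈ Set.Icc (0 : ℝ) 1 := by
  unfold feedback
  split_ifs
  · exact hl i
  · simp

open Classical in
lemma armEstimator_of_mem (hC : IsCliquePartition G C) (fb : Fin K → ℝ) {i : Fin K} {j : Fin κ}
    (hi : i ∈ C j) :
    armEstimator C s x fb i = if x.1 = .inl j then fb i / s.p (.inl j) else 0 := by
  obtain ⟨m, a⟩ := x
  rw [armEstimator, dif_pos (hC.mem_inNbrs hi)]
  rcases m with j' | v
  · by_cases hj : j' = j
    · subst hj
      simp [hi]
    · have hi' : i ∉ C j' := fun hi' => hj (hC.eq_of_mem hi' hi)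
      simp [hj, hi']
  · simp

lemma armEstimator_noLoop (fb : Fin K → ℝ) (v : NoLoop G) :
    armEstimator C s x fb v = if (v : Fin K) ≠ x.2 then fb v / (1 - s.p (.inr v)) else 0 := by
  rw [armEstimator, dif_neg v.2]

lemma armEstimator_nonneg (hC : IsCliquePartition G C) (hp : s.p ∈ metaDomain T G κ)
    (hl : ∀ i, loss i ∈ Set.Icc (0 : ℝ) 1) (i : Fin K) :
    0 ≤ armEstimator C s x (feedback G loss x.2) i := by
  have hfb := (feedback_mem (G := G) hl x.2 i).1
  by_cases hi : i ∈ inNbrs G i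
  · obtain ⟨j, hj⟩ := (hC.covers i).2 hi
    rw [armEstimator_of_mem hC _ hj]
    split_ifs
    · exact div_nonneg hfb (hp.1.1 _)
    · exact le_rfl
  · have hle : s.p (.inr ⟨i, hi⟩) ≤ 1 :=
      hp.1.2 ▸ single_le_sum (fun m _ => hp.1.1 m) (mem_univ _)
    rw [armEstimator_noLoop _ ⟨i, hi⟩]
    split_ifs
    · exact div_nonneg hfb (sub_nonneg.2 hle)
    · exact le_rfl

lemma mul_div_le_one {a y : ℝ} (hy : y ≤ 1) : a * (y / a) ≤ 1 := by
  rcases eq_or_ne a 0 with rfl | ha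
  · simp
  · rwa [mul_div_cancel₀ _ ha]

open Classical in
lemma mul_armEstimator_le (hC : IsCliquePartition G C) (hl : ∀ i, loss i ∈ Set.Icc (0 : ℝ) 1)
    {i : Fin K} {j : Fin κ} (hi : i ∈ C j) :
    s.p (.inl j) * armEstimator C s x (feedback G loss x.2) i
      ≤ if x.1 = .inl j then 1 else 0 := by
  rw [armEstimator_of_mem hC _ hi]
  split_ifs
  · exact mul_div_le_one (feedback_mem hl x.2 i).2
  · simp

lemma mul_armEstimator_noLoop_le (hl : ∀ i, loss i ∈ Set.Icc (0 : ℝ) 1) (v : NoLoop G) :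
    (1 - s.p (.inr v)) * armEstimator C s x (feedback G loss x.2) v ≤ 1 := by
  rw [armEstimator_noLoop _ v]
  split_ifs
  · exact mul_div_le_one (feedback_mem hl x.2 v).2
  · simp

variable (hC : IsCliquePartition G C) (hl : ∀ i, loss i ∈ Set.Icc (0 : ℝ) 1)
  (hh : ∀ j, (s.hedge j).prob ∈ hedgeDomain T (C j))
include hC hl hh

open Classical in
lemma mul_metaEst_clique_le (j : Fin κ) :
    s.p (.inl j) * metaEst C loss s x (.inl j) ≤ if x.1 = .inl j then 1 else 0 := by
  simp only [metaEst, metaEstimator, dotProduct, mul_sum]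
  calc _ ≤ ∑ i, (s.hedge j).prob i * (if x.1 = .inl j then 1 else 0) := by
        refine sum_le_sum fun i _ => ?_
        by_cases hi : i ∈ C j
        · rw [mul_left_comm]
          exact mul_le_mul_of_nonneg_left (mul_armEstimator_le hC hl hi) ((hh j).1.1 i)
        · simp [(hh j).2.2 i hi]
    _ = _ := by rw [← sum_mul, (hh j).1.2, one_mul]

lemma sum_mul_metaEst_clique_le : ∑ j, s.p (.inl j) * metaEst C loss s x (.inl j) ≤ 1 := by
  classical
  refine (sum_le_sum fun j _ => mul_metaEst_clique_le hC hl hh j).trans ?_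
  rcases x.1 with j' | v <;> simp

lemma lossBound_metaEst (hp : s.p ∈ metaDomain T G κ) : LossBound s.p (metaEst C loss s x) where
  nonneg := by
    have hnonneg := armEstimator_nonneg (x := x) hC hp hl
    rintro (j | v)
    · exact dotProduct_nonneg_of_nonneg (hh j).1.1 hnonneg
    · exact hnonneg v
  clique j := by
    classical
    refine (mul_metaEst_clique_le hC hl hh j).trans ?_
    split_ifs <;> norm_num
  noLoop v := mul_armEstimator_noLoop_le hl v

end Estimators

/-- The loss of the meta-node `m` if it has no self-loop, and zero if it is a clique. -/
def noLoopLoss (g : Meta G κ → ℝ) : Meta G κ → ℝ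
  | .inl _ => 0
  | .inr v => g (.inr v)

lemma LossBound.sum_noLoop_le {p g : Meta G κ → ℝ} (hg : LossBound p g) (hT : 0 < T)
    (hp : p ∈ metaDomain T G κ) (m : Meta G κ) :
    ∑ v : NoLoop G, p (.inr v) * g (.inr v) ≤ 1 / p m + noLoopLoss g m := by
  classical
  have hm := pos_of_mem_metaDomain hT hp m
  have hterm : ∀ v : NoLoop G, p (.inr v) * g (.inr v)
      ≤ p (.inr v) * (1 / p m) + if .inr v = m then noLoopLoss g m else 0 := by
    intro v
    have hv := pos_of_mem_metaDomain hT hp (.inr v)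
    have hgv := hg.nonneg (.inr v)
    split_ifs with h
    · subst h
      have hle : p (.inr v) ≤ 1 := hp.1.2 ▸ single_le_sum (fun m _ => hp.1.1 m) (mem_univ _)
      have : 0 ≤ p (.inr v) * (1 / p (.inr v)) := by positivity
      simp only [noLoopLoss]
      linarith [mul_le_of_le_one_left hgv hle]
    · rw [add_zero]
      gcongr
      rw [le_div_iff₀ hm]
      nlinarith [hg.noLoop v, add_le_one_of_mem_metaDomain hp h]
  have hmass : ∑ v : NoLoop G, p (.inr v) ≤ 1 := by
    have hsum := hp.1.2
    rw [Fintype.sum_sum_type] at hsum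
    linarith [sum_nonneg fun (j : Fin κ) (_ : j ∈ univ) => hp.1.1 (.inl j)]
  calc _ ≤ ∑ v : NoLoop G, (p (.inr v) * (1 / p m)
        + if .inr v = m then noLoopLoss g m else 0) := sum_le_sum fun v _ => hterm v
    _ = (∑ v : NoLoop G, p (.inr v)) * (1 / p m) + noLoopLoss g m := by
        rw [sum_add_distrib, ← sum_mul]
        rcases m with j | v <;> simp [noLoopLoss]
    _ ≤ 1 / p m + noLoopLoss g m := by
        gcongr
        exact mul_le_of_le_one_left (by positivity) hmass

/-! ### Validity of the state -/

/-- The learning rate `a` of a clique and its threshold `ρ` have been updated consistently since the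
restart with learning rate `η`: the rate grows by a factor `exp (1 / log T)` only when the threshold
at least doubles. -/
structure RateValid (T : ℕ) (η a ρ : ℝ) : Prop where
  two_le_rho : 2 ≤ ρ
  rho_le : ρ ≤ 2 * T
  rate_pos : 0 < a
  rate_le : a ≤ η * exp (log (ρ / 2) / (log 2 * log T))

lemma exp_le_five {x : ℝ} (hx : x ≤ 3 / 2) : exp x ≤ 5 := by
  have hsq : exp (3 / 2) ^ 2 = exp 1 ^ 3 := by
    rw [← exp_nat_mul, ← exp_nat_mul]
    norm_num
  have hcube : exp 1 ^ 3 ≤ 2.7182818286 ^ 3 := by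
    gcongr
    exact exp_one_lt_d9.le
  have hle : exp (3 / 2) ^ 2 ≤ 5 ^ 2 := by
    norm_num at hcube hsq ⊢
    linarith
  exact (exp_le_exp.2 hx).trans (le_of_sq_le_sq hle (by norm_num))

lemma RateValid.rate_le_five {η a ρ : ℝ} (h : RateValid T η a ρ) (hT : 1 ≤ log T)
    (hη : 0 < η) : a ≤ 5 * η := by
  have hρ : log (ρ / 2) ≤ log T :=
    log_le_log (by linarith [h.two_le_rho]) (by linarith [h.rho_le])
  have hexp : exp (log (ρ / 2) / (log 2 * log T)) ≤ 5 := by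
    refine exp_le_five ?_
    rw [div_le_iff₀ (by positivity)]
    nlinarith [log_two_gt_d9]
  linarith [h.rate_le, mul_le_mul_of_nonneg_left hexp hη.le]

lemma RateValid.increase {η a ρ q : ℝ} (h : RateValid T η a ρ) (hT : 1 ≤ log T) (hη : 0 < η)
    (hq : ρ < 1 / q) (hq' : 1 / q ≤ T) : RateValid T η (a * exp (1 / log T)) (2 / q) := by
  have hρ := h.two_le_rho
  have ha := h.rate_pos
  rw [show 2 / q = 2 * (1 / q) by ring]
  refine ⟨by linarith, by linarith, by positivity, ?_⟩
  have hlog : log (ρ / 2) + log 2 ≤ log (2 * (1 / q) / 2) := by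
    rw [← log_mul (by linarith) two_ne_zero]
    exact log_le_log (by linarith) (by linarith)
  calc a * exp (1 / log T)
      ≤ η * exp (log (ρ / 2) / (log 2 * log T)) * exp (1 / log T) := by
        gcongr
        exact h.rate_le
    _ = η * exp ((log (ρ / 2) + log 2) / (log 2 * log T)) := by
        rw [mul_assoc, ← exp_add]
        congr 2
        field_simp
    _ ≤ η * exp (log (2 * (1 / q) / 2) / (log 2 * log T)) := by
        have := log_pos one_lt_two
        gcongr

lemma rateValid_restart {η : ℝ} (hη : 0 < η) (hκ : 0 < κ) (hκT : κ ≤ T) :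
    RateValid T η η (2 * κ) := by
  have hκ1 : (1 : ℝ) ≤ κ := by exact_mod_cast hκ
  refine ⟨by linarith, by gcongr, hη, le_mul_of_one_le_right hη.le (one_le_exp ?_)⟩
  have := log_natCast_nonneg T
  have := log_pos one_lt_two
  have : 0 ≤ log (2 * (κ : ℝ) / 2) := log_nonneg (by linarith)
  positivity

/-- The invariants of the state at the beginning of any round. -/
structure State.Valid (T : ℕ) (C : Fin κ → Finset (Fin K)) (s : State G κ) : Prop where
  eta_pos : 0 < s.eta
  eta_le : s.eta * (2000 * log T * log (K * T) ^ 2) ≤ 1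
  p_mem : s.p ∈ metaDomain T G κ
  hedge_valid : ∀ j, (s.hedge j).Valid T (C j)
  rate_valid : ∀ j, RateValid T s.eta (s.rate j) (s.rho j)
  cumLoss_nonneg : 0 ≤ s.cumLoss
  cumLoss_lt : s.eta * s.cumLoss < (κ + 1) / s.eta

lemma valid_restart (hS : Setting T G C) {c η : ℝ} (hc : 0 ≤ c) (hη : 0 < η)
    (hη1 : η * (2000 * log T * log (K * T) ^ 2) ≤ 1) : (restart T G C c η).Valid T C := by
  obtain ⟨m⟩ := hS.nonempty_meta
  have hκT : κ ≤ T := by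
    have hβT := hS.two_mul_metaCard_le
    have hκβ : κ ≤ metaCard G κ := kappa_le_metaCard
    exact hκβ.trans (by exact_mod_cast (by linarith : (metaCard G κ : ℝ) ≤ T))
  exact {
    eta_pos := hη
    eta_le := hη1
    p_mem := (restart_div_le hS.T_pos hη hc ⟨_, metaComparator_mem hS m⟩).1
    hedge_valid j := hedgeInit_valid hS.T_pos (hS.partition.nonempty j)
    rate_valid j := rateValid_restart hη j.pos hκT
    cumLoss_nonneg := le_rfl
    cumLoss_lt := by
      simp only [restart, mul_zero]
      positivity }

/-- The state after a round that does not trigger a restart. -/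
def advance (T : ℕ) (G : Digraph (Fin K)) (C : Fin κ → Finset (Fin K)) (c : ℝ)
    (loss : Fin K → ℝ) (s : State G κ) (x : Choice G κ) : State G κ :=
  let p' := omdStep (metaDomain T G κ) (hybridReg c s.eta s.rate) (metaEst C loss s x) s.p
  { eta := s.eta
    rate := fun j =>
      if s.rho j < 1 / p' (.inl j) then s.rate j * exp (1 / log T) else s.rate j
    rho := fun j => if s.rho j < 1 / p' (.inl j) then 2 / p' (.inl j) else s.rho j
    p := p'
    hedge := fun j =>
      hedgeStep T (C j) (s.hedge j) (armEstimator C s x (feedback G loss x.2))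
    cumLoss := s.cumLoss + s.p ⬝ᵥ metaEst C loss s x }

open Classical in
lemma step_eq (c : ℝ) (loss : Fin K → ℝ) (s : State G κ) (x : Choice G κ) :
    step T G C c loss s x =
      if ((κ : ℝ) + 1) / s.eta ≤ s.eta * (s.cumLoss + s.p ⬝ᵥ metaEst C loss s x) then
        restart T G C c (s.eta / 2) else advance T G C c loss s x := by
  simp only [step, advance]

namespace State.Valid

variable {c : ℝ} {s : State G κ} {loss : Fin K → ℝ}

lemma rate_le_five (hS : Setting T G C) (hs : s.Valid T C) (j : Fin κ) :
    s.rate j ≤ 5 * s.eta :=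
  (hs.rate_valid j).rate_le_five hS.one_le_log hs.eta_pos

lemma mul_eta_le_one (hS : Setting T G C) (hs : s.Valid T C) : 8000 * s.eta ≤ 1 :=
  hS.mul_rate_le_one hs.eta_pos hs.eta_le

lemma lossBound (hS : Setting T G C) (hs : s.Valid T C) (hl : ∀ i, loss i ∈ Set.Icc (0 : ℝ) 1)
    (x : Choice G κ) : LossBound s.p (metaEst C loss s x) :=
  lossBound_metaEst hS.partition hl (fun j => (hs.hedge_valid j).prob_mem) hs.p_mem

lemma dotProduct_metaEst_nonneg (hS : Setting T G C) (hs : s.Valid T C)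
    (hl : ∀ i, loss i ∈ Set.Icc (0 : ℝ) 1) (x : Choice G κ) :
    0 ≤ s.p ⬝ᵥ metaEst C loss s x :=
  dotProduct_nonneg_of_nonneg hs.p_mem.1.1 (hs.lossBound hS hl x).nonneg

lemma dotProduct_metaEst_le (hS : Setting T G C) (hs : s.Valid T C)
    (hl : ∀ i, loss i ∈ Set.Icc (0 : ℝ) 1) (x : Choice G κ) (m : Meta G κ) :
    s.p ⬝ᵥ metaEst C loss s x ≤ 1 + 1 / s.p m + noLoopLoss (metaEst C loss s x) m := by
  rw [dotProduct, Fintype.sum_sum_type]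
  linarith [sum_mul_metaEst_clique_le (x := x) hS.partition hl
      fun j => (hs.hedge_valid j).prob_mem,
    (hs.lossBound hS hl x).sum_noLoop_le hS.T_pos hs.p_mem m]

lemma omdStep (hS : Setting T G C) (hc : 4 ≤ c) (hs : s.Valid T C)
    (hl : ∀ i, loss i ∈ Set.Icc (0 : ℝ) 1) (x : Choice G κ) :
    (advance T G C c loss s x).p ∈ metaDomain T G κ ∧ ∀ u ∈ metaDomain T G κ,
      s.p ⬝ᵥ metaEst C loss s x - u ⬝ᵥ metaEst C loss s x ≤ hybridDiv c s.eta s.rate u s.p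
        - hybridDiv c s.eta s.rate u (advance T G C c loss s x).p
        + 40 * s.eta * (s.p ⬝ᵥ metaEst C loss s x) :=
  hybrid_omdStep hS.T_pos hs.eta_pos (by linarith [hs.mul_eta_le_one hS, hs.eta_pos]) hc
    (fun j => (hs.rate_valid j).rate_pos) (hs.rate_le_five hS) hs.p_mem (hs.lossBound hS hl x)

lemma rateValid_advance (hS : Setting T G C) (hc : 4 ≤ c) (hs : s.Valid T C)
    (hl : ∀ i, loss i ∈ Set.Icc (0 : ℝ) 1) (x : Choice G κ) (j : Fin κ) :
    RateValid T s.eta ((advance T G C c loss s x).rate j) ((advance T G C c loss s x).rho j) := by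
  have hp' := (hs.omdStep hS hc hl x).1
  have hinv : 1 / (advance T G C c loss s x).p (.inl j) ≤ T := by
    have hT : (0 : ℝ) < T := by exact_mod_cast hS.T_pos
    exact (one_div_le hT (pos_of_mem_metaDomain hS.T_pos hp' _)).1 (hp'.2 _)
  by_cases hρ : s.rho j < 1 / (advance T G C c loss s x).p (.inl j)
  · have hincrease := (hs.rate_valid j).increase hS.one_le_log hs.eta_pos hρ hinv
    simp only [advance] at hρ hincrease ⊢
    rwa [if_pos hρ, if_pos hρ]
  · simp only [advance] at hρ ⊢
    rw [if_neg hρ, if_neg hρ]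
    exact hs.rate_valid j

lemma step (hS : Setting T G C) (hc : 4 ≤ c) (hs : s.Valid T C)
    (hl : ∀ i, loss i ∈ Set.Icc (0 : ℝ) 1) (x : Choice G κ) :
    (step T G C c loss s x).Valid T C := by
  classical
  have hη := hs.eta_pos
  rw [step_eq]
  split_ifs with hrestart
  · refine valid_restart hS (by linarith) (half_pos hη) (le_trans ?_ hs.eta_le)
    have := hS.one_le_log
    gcongr
    linarith
  · exact {
      eta_pos := hη
      eta_le := hs.eta_le
      p_mem := (hs.omdStep hS hc hl x).1
      hedge_valid j := (hs.hedge_valid j).hedgeStep hS.T_pos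
        (armEstimator_nonneg hS.partition hs.p_mem hl)
      rate_valid j := hs.rateValid_advance hS hc hl x j
      cumLoss_nonneg := add_nonneg hs.cumLoss_nonneg (hs.dotProduct_metaEst_nonneg hS hl x)
      cumLoss_lt := lt_of_not_ge hrestart }

end State.Valid

end

/-! ### One epoch of the meta-algorithm -/

section Epoch

variable {K κ T : ℕ} {G : Digraph (Fin K)} {C : Fin κ → Finset (Fin K)} {c η : ℝ} {s : State G κ}
  {loss : Fin K → ℝ}

/-- The scale of the regret in an epoch with learning rate `η`. -/
def epochScale (G : Digraph (Fin K)) (κ : ℕ) (c η : ℝ) : ℝ :=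
  (κ + 1) / η + c * metaCard G κ

lemma div_le_epochScale (hc : 0 ≤ c) : (κ + 1) / η ≤ epochScale G κ c η :=
  le_add_of_nonneg_right (by positivity)

lemma one_div_le_epochScale (hc : 0 ≤ c) (hη : 0 < η) : 1 / η ≤ epochScale G κ c η :=
  le_trans (by gcongr; simp) (div_le_epochScale hc)

lemma State.Valid.one_le_epochScale (hS : Setting T G C) (hc : 0 ≤ c) (hs : s.Valid T C) :
    1 ≤ epochScale G κ c s.eta := by
  have hη := hs.eta_pos
  refine le_trans ?_ (one_div_le_epochScale hc hη)
  rw [le_div_iff₀ hη]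
  linarith [hs.mul_eta_le_one hS]

lemma State.Valid.eta_mul_cumLoss_le (hc : 0 ≤ c) (hs : s.Valid T C) :
    s.eta * s.cumLoss ≤ epochScale G κ c s.eta :=
  hs.cumLoss_lt.le.trans (div_le_epochScale hc)

/-- The potential of a threshold: it grows with the threshold no faster than the divergence that an
increase of the learning rate gives back. -/
def thresholdGain (ρ : ℝ) : ℝ := ρ / 80 - log ρ / 10

lemma inv_sub_log_two_le_barrierGap {u p : ℝ} (hu : 1 / 2 ≤ u) (hp : 0 < p) :
    1 / p / 4 - log 2 ≤ barrierGap (u / p) := by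
  have hgap := half_sub_log_two_le_barrierGap (div_pos (by linarith : 0 < u) hp)
  have hdiv : 1 / 2 / p ≤ u / p := by gcongr
  rw [div_right_comm] at hdiv
  linarith

lemma thresholdGain_increase_le {u q ρ : ℝ} (hu : 1 / 2 ≤ u) (hq : 0 < q) (hρ : 0 < ρ)
    (h : ρ < 1 / q) : thresholdGain (2 / q) - thresholdGain ρ ≤ 1 / 10 * barrierGap (u / q) := by
  have hlog : log ρ + log 2 ≤ log (2 / q) := by
    rw [← log_mul hρ.ne' two_ne_zero, div_eq_mul_one_div, mul_comm 2]
    exact log_le_log (by positivity) (by linarith)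
  have hgap := inv_sub_log_two_le_barrierGap hu hq
  rw [thresholdGain, thresholdGain, div_eq_mul_one_div 2 q]
  rw [div_eq_mul_one_div 2 q] at hlog
  linarith

lemma one_div_mul_half_le_sub_one_div_mul_exp {a x : ℝ} (ha : 0 < a) (hx : 0 ≤ x) (hx1 : x ≤ 1) :
    1 / a * (x / 2) ≤ 1 / a - 1 / (a * exp x) := by
  have hexp : exp (-x) ≤ 1 - x / 2 := by
    rw [exp_neg, inv_le_comm₀ (exp_pos x) (by linarith)]
    refine le_trans ?_ (add_one_le_exp x)
    rw [inv_le_iff_one_le_mul₀ (by linarith)]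
    nlinarith
  calc 1 / a * (x / 2) = 1 / a * (1 - (1 - x / 2)) := by ring
    _ ≤ 1 / a * (1 - exp (-x)) := by gcongr
    _ = 1 / a - 1 / (a * exp x) := by rw [exp_neg]; field_simp

lemma rate_increase_gain {η a L ρ q u : ℝ} (hη : 0 < η) (ha : 0 < a) (ha5 : a ≤ 5 * η)
    (hL : 1 ≤ L) (hu : 1 / 2 ≤ u) (hq : 0 < q) (hρ : 0 < ρ) (h : ρ < 1 / q) :
    1 / (a * exp (1 / L)) * barrierGap (u / q) + thresholdGain (2 / q) / (η * L)
      ≤ 1 / a * barrierGap (u / q) + thresholdGain ρ / (η * L) := by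
  have hL0 : 0 < L := by linarith
  have hgap : 0 ≤ barrierGap (u / q) := barrierGap_nonneg (div_pos (by linarith) hq)
  have hrate : 1 / (η * L) * (1 / 10) ≤ 1 / a - 1 / (a * exp (1 / L)) :=
    calc 1 / (η * L) * (1 / 10) = 1 / (5 * η) * (1 / L / 2) := by field_simp; norm_num
      _ ≤ 1 / a * (1 / L / 2) := by gcongr
      _ ≤ _ := one_div_mul_half_le_sub_one_div_mul_exp ha (by positivity)
        ((div_le_one hL0).2 hL)
  have hthreshold : 1 / (η * L) * (thresholdGain (2 / q) - thresholdGain ρ)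
      ≤ (1 / a - 1 / (a * exp (1 / L))) * barrierGap (u / q) :=
    calc _ ≤ 1 / (η * L) * (1 / 10 * barrierGap (u / q)) := by
          gcongr
          exact thresholdGain_increase_le hu hq hρ h
      _ = 1 / (η * L) * (1 / 10) * barrierGap (u / q) := by ring
      _ ≤ _ := mul_le_mul_of_nonneg_right hrate hgap
  rw [div_eq_mul_one_div (thresholdGain (2 / q)), div_eq_mul_one_div (thresholdGain ρ)]
  linarith

/-- The gain accumulated so far from the increases of the learning rate of the meta-node `m`. -/
def rateGain (T : ℕ) (s : State G κ) : Meta G κ → ℝ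
  | .inl j => thresholdGain (s.rho j) / (s.eta * log T)
  | .inr _ => 0

/-- A potential bound for the meta-algorithm in the current epoch, compared to the meta-node `m`:
here `U` is an upper bound on the loss of the comparator of `m` since the restart. -/
def MetaBound (T : ℕ) (c : ℝ) (m : Meta G κ) (s : State G κ) (U : ℝ) : Prop :=
  s.cumLoss - U + hybridDiv c s.eta s.rate (metaComparator T m) s.p + rateGain T s m
    ≤ 2 * epochScale G κ c s.eta * log T + 40 * s.eta * s.cumLoss

lemma MetaBound.mono {m : Meta G κ} {U U' : ℝ} (h : MetaBound T c m s U) (hU : U ≤ U') :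
    MetaBound T c m s U' := by
  unfold MetaBound at h ⊢
  linarith

lemma rateGain_restart_le (hS : Setting T G C) (hc : 0 ≤ c) (hη : 0 < η) (m : Meta G κ) :
    rateGain T (restart T G C c η) m ≤ epochScale G κ c η * log T := by
  have hlog := hS.one_le_log
  have hscale : 0 ≤ epochScale G κ c η :=
    le_trans (by positivity) (one_div_le_epochScale hc hη)
  rcases m with j | v
  · have hκ : (1 : ℝ) ≤ κ := by exact_mod_cast j.pos
    have hlogκ := log_nonneg (show 1 ≤ 2 * (κ : ℝ) by linarith)
    calc thresholdGain (2 * κ) / (η * log T) ≤ (κ + 1) / η :=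
          div_le_div₀ (by linarith) (by unfold thresholdGain; linarith) hη
            (le_mul_of_one_le_right hη.le hlog)
      _ ≤ epochScale G κ c η := div_le_epochScale hc
      _ ≤ epochScale G κ c η * log T := le_mul_of_one_le_right hscale hlog
  · simp only [rateGain]
    positivity

lemma metaBound_restart (hS : Setting T G C) (hc : 0 ≤ c) (hη : 0 < η) (m : Meta G κ) :
    MetaBound T c m (restart T G C c η) 0 := by
  have hdiv := (restart_div_le hS.T_pos hη hc ⟨_, metaComparator_mem hS m⟩).2 _
    (metaComparator_mem hS m)
  have hgain := rateGain_restart_le hS hc hη m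
  simp only [epochScale] at hgain
  simp only [MetaBound, restart, epochScale] at hgain ⊢
  linarith

lemma hybridCoordDiv_advance_le (hs : s.Valid T C) (x : Choice G κ) (m : Meta G κ) {u y : ℝ}
    (hu : 0 < u) (hy : 0 < y) :
    hybridCoordDiv c s.eta (advance T G C c loss s x).rate m u y
      ≤ hybridCoordDiv c s.eta s.rate m u y := by
  rcases m with j | v
  · have hr := (hs.rate_valid j).rate_pos
    have hgap := barrierGap_nonneg (div_pos hu hy)
    have hlog : 0 ≤ 1 / log T := one_div_nonneg.2 (log_natCast_nonneg T)
    simp only [hybridCoordDiv, advance]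
    gcongr
    split_ifs
    · exact le_mul_of_one_le_right hr.le (one_le_exp hlog)
    · exact le_rfl
  · exact le_rfl

section Advance

variable (hS : Setting T G C) (hc : 4 ≤ c) (hs : s.Valid T C)
  (hl : ∀ i, loss i ∈ Set.Icc (0 : ℝ) 1) (x : Choice G κ)
include hS hc hs hl

lemma hybridCoordDiv_advance_add_rateGain_le (m : Meta G κ) :
    hybridCoordDiv c s.eta (advance T G C c loss s x).rate m (metaComparator T m m)
        ((advance T G C c loss s x).p m) + rateGain T (advance T G C c loss s x) m
      ≤ hybridCoordDiv c s.eta s.rate m (metaComparator T m m)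
          ((advance T G C c loss s x).p m) + rateGain T s m := by
  rcases m with j | v
  · have hq := pos_of_mem_metaDomain hS.T_pos (hs.omdStep hS hc hl x).1 (.inl j)
    have hrate := hs.rate_valid j
    by_cases hρ : s.rho j < 1 / (advance T G C c loss s x).p (.inl j)
    · have hincrease := rate_increase_gain hs.eta_pos hrate.rate_pos (hs.rate_le_five hS j)
        hS.one_le_log (half_le_metaComparator hS (.inl j)) hq
        (by linarith [hrate.two_le_rho]) hρ
      simp only [advance] at hρ
      simpa only [hybridCoordDiv, rateGain, advance, if_pos hρ] using hincrease
    · simp only [advance] at hρ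
      simp only [hybridCoordDiv, rateGain, advance, if_neg hρ, le_rfl]
  · exact le_rfl

lemma hybridDiv_advance_add_rateGain_le (m : Meta G κ) :
    hybridDiv c s.eta (advance T G C c loss s x).rate (metaComparator T m)
        (advance T G C c loss s x).p + rateGain T (advance T G C c loss s x) m
      ≤ hybridDiv c s.eta s.rate (metaComparator T m) (advance T G C c loss s x).p
        + rateGain T s m := by
  classical
  have hp' := pos_of_mem_metaDomain hS.T_pos (hs.omdStep hS hc hl x).1
  have hu := pos_of_mem_metaDomain hS.T_pos (metaComparator_mem hS m)
  have hcoord := hybridCoordDiv_advance_add_rateGain_le hS hc hs hl x m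
  have hrest := sum_le_sum fun m' (_ : m' ∈ univ.erase m) =>
    hybridCoordDiv_advance_le (c := c) (loss := loss) hs x m' (hu m') (hp' m')
  rw [hybridDiv, hybridDiv, ← add_sum_erase _ _ (mem_univ m), ← add_sum_erase _ _ (mem_univ m)]
  linarith

lemma MetaBound.advance {m : Meta G κ} {U : ℝ} (h : MetaBound T c m s U) :
    MetaBound T c m (advance T G C c loss s x)
      (U + metaComparator T m ⬝ᵥ metaEst C loss s x) := by
  have homd := (hs.omdStep hS hc hl x).2 _ (metaComparator_mem hS m)
  have hpotential := hybridDiv_advance_add_rateGain_le hS hc hs hl x m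
  unfold MetaBound at h ⊢
  simp only [GraphBandit.advance] at homd hpotential ⊢
  linarith

end Advance

/-- The part of `rateGain` that pays for the regret of the Hedge instance of a clique. -/
def rhoGain (T : ℕ) (s : State G κ) : Meta G κ → ℝ
  | .inl j => s.rho j / (80 * (s.eta * log T))
  | .inr _ => 0

lemma rhoGain_le (hS : Setting T G C) (hs : s.Valid T C) (m : Meta G κ) :
    rhoGain T s m ≤ rateGain T s m + 1 / s.eta := by
  have hη := hs.eta_pos
  have hlogT : 0 < log T := by linarith [hS.one_le_log]
  rcases m with j | v
  · have hρ := hs.rate_valid j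
    have hlogρ : log (s.rho j) ≤ 2 * log T := by
      have hT : (0 : ℝ) < T := by exact_mod_cast hS.T_pos
      have hle := log_le_log (by linarith [hρ.two_le_rho]) hρ.rho_le
      have hlog_two := log_le_log two_pos (show (2 : ℝ) ≤ T by linarith [hS.four_le])
      rw [log_mul two_ne_zero hT.ne'] at hle
      linarith
    have hsmall : log (s.rho j) / (10 * (s.eta * log T)) ≤ 1 / s.eta := by
      rw [div_le_div_iff₀ (by positivity) hη]
      nlinarith [mul_pos hη hlogT]
    calc s.rho j / (80 * (s.eta * log T))
        = thresholdGain (s.rho j) / (s.eta * log T) + log (s.rho j) / (10 * (s.eta * log T)) := by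
          unfold thresholdGain
          field_simp
          ring
      _ ≤ _ := by
        simp only [rateGain]
        linarith
  · simp only [rhoGain, rateGain]
    positivity

lemma two_div_le_hybridDiv (hS : Setting T G C) (hc : 8 ≤ c) (hs : s.Valid T C) (m : Meta G κ) :
    2 * (1 / s.p m) ≤ hybridDiv c s.eta s.rate (metaComparator T m) s.p + 6 := by
  have hη := hs.eta_pos
  have hu := pos_of_mem_metaDomain hS.T_pos (metaComparator_mem hS m)
  have hp := pos_of_mem_metaDomain hS.T_pos hs.p_mem
  have hgap0 := barrierGap_nonneg (div_pos (hu m) (hp m))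
  have hgap := inv_sub_log_two_le_barrierGap (half_le_metaComparator hS m) (hp m)
  have hdiv := hybridCoordDiv_le_hybridDiv (c := c) hη (by linarith)
    (fun j => (hs.rate_valid j).rate_pos) hu hp m
  suffices h : 8 * barrierGap (metaComparator T m m / s.p m)
      ≤ hybridCoordDiv c s.eta s.rate m (metaComparator T m m) (s.p m) by
    linarith [log_two_lt_d9]
  rcases m with j | v
  · refine mul_le_mul_of_nonneg_right ?_ hgap0
    rw [le_div_iff₀ (hs.rate_valid j).rate_pos]
    linarith [hs.rate_le_five hS j, hs.mul_eta_le_one hS]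
  · have hentropy : 0 ≤ 1 / s.eta * (s.p (.inr v)
        * klFun (metaComparator (κ := κ) T (.inr v) (.inr v) / s.p (.inr v))) := by
      have := klFun_nonneg (div_pos (hu (.inr v)) (hp (.inr v))).le
      have := hp (.inr v)
      positivity
    exact (mul_le_mul_of_nonneg_right hc hgap0).trans (le_add_of_nonneg_left hentropy)

lemma MetaBound.sub_le (hS : Setting T G C) (hc : 8 ≤ c) (hs : s.Valid T C) {m : Meta G κ} {U : ℝ}
    (h : MetaBound T c m s U) :
    s.cumLoss - U + 2 * (1 / s.p m) + rhoGain T s m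
      ≤ (2 * log T + 47) * epochScale G κ c s.eta := by
  have hc0 : 0 ≤ c := by linarith
  have hscale := hs.one_le_epochScale hS hc0
  have hinv := one_div_le_epochScale (G := G) (κ := κ) hc0 hs.eta_pos
  unfold MetaBound at h
  linarith [two_div_le_hybridDiv hS hc hs m, rhoGain_le hS hs m, hs.eta_mul_cumLoss_le hc0]

/-- The estimated loss of arm `i` in a round. -/
abbrev armEst (C : Fin κ → Finset (Fin K)) (i : Fin K) (loss : Fin K → ℝ) (s : State G κ)
    (x : Choice G κ) : ℝ :=
  armEstimator C s x (feedback G loss x.2) i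

/-- A bound on the excess loss, in a round, of the comparators over the arm or meta-node that they
stand for. The comparator of Hedge is mixed with the distribution `mix`. -/
def slack (T : ℕ) (C : Fin κ → Finset (Fin K)) (mix loss : Fin K → ℝ) (s : State G κ)
    (x : Choice G κ) : ℝ :=
  1 / T * (∑ m, metaEst C loss s x m + mix ⬝ᵥ armEstimator C s x (feedback G loss x.2))

/-- The predicate `P s Y W` holds throughout an epoch, for its current state `s`, the estimated loss
`Y` of arm `i` and the slack `W` since the restart, and it bounds the regret in the epoch by `Q`
times its scale. The bound `le_add` is for the last round of an epoch, which triggers a restart and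
has no state after it in the epoch. -/
structure EpochBound (T : ℕ) (C : Fin κ → Finset (Fin K)) (c Q : ℝ) (i : Fin K)
    (mix : Fin K → ℝ) (P : State G κ → ℝ → ℝ → Prop) : Prop where
  start : ∀ η, 0 < η → P (restart T G C c η) 0 0
  advance : ∀ s Y W loss x, s.Valid T C → (∀ i, loss i ∈ Set.Icc (0 : ℝ) 1) → P s Y W →
    P (advance T G C c loss s x) (Y + armEst C i loss s x) (W + slack T C mix loss s x)
  le : ∀ s Y W, s.Valid T C → P s Y W → s.cumLoss - Y ≤ Q * epochScale G κ c s.eta + W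
  le_add : ∀ s Y W loss x, s.Valid T C → (∀ i, loss i ∈ Set.Icc (0 : ℝ) 1) → P s Y W →
    s.cumLoss + s.p ⬝ᵥ metaEst C loss s x - (Y + armEst C i loss s x)
      ≤ Q * epochScale G κ c s.eta + W

/-! ### Epochs compared to a node without a self-loop -/

lemma metaBound_noLoop_sub_le (hS : Setting T G C) (hc : 8 ≤ c) (hs : s.Valid T C)
    {v : NoLoop G} {Y W : ℝ} (h : MetaBound T c (.inr v) s (Y + W)) :
    s.cumLoss - Y + 1 / s.p (.inr v) + 1
      ≤ 800 * log (K * T) ^ 3 * epochScale G κ c s.eta + W := by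
  have hscale := hs.one_le_epochScale hS (c := c) (by linarith)
  have hinv := one_div_pos.2 (pos_of_mem_metaDomain hS.T_pos hs.p_mem (.inr v))
  have hlogKT := hS.two_le_log
  have hconst : 2 * log T + 48 ≤ 800 * log (K * T) ^ 3 := by
    have : (2 : ℝ) ^ 2 ≤ log (K * T) ^ 2 := by gcongr
    nlinarith [hS.log_le_log]
  have hregret := h.sub_le hS hc hs
  have hmul := mul_le_mul_of_nonneg_right hconst (zero_le_one.trans hscale)
  simp only [rhoGain, add_zero] at hregret
  linarith

lemma epochBound_noLoop (hS : Setting T G C) (hc : 8 ≤ c) (v : NoLoop G) :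
    EpochBound T C c (800 * log (K * T) ^ 3) v 0
      fun s Y W => MetaBound T c (.inr v) s (Y + W) where
  start η hη := by
    rw [add_zero]
    exact metaBound_restart hS (by linarith) hη _
  advance s Y W loss x hs hl h := by
    have hmix := metaComparator_dotProduct_le (T := T) (.inr v) (hs.lossBound hS hl x).nonneg
    have hslack : slack T C 0 loss s x = 1 / T * ∑ m, metaEst C loss s x m := by simp [slack]
    have hv : metaEst C loss s x (.inr v) = armEst C v loss s x := rfl
    exact (h.advance hS (by linarith) hs hl x).mono (by linarith)
  le s Y W hs h := by
    have hinv := one_div_pos.2 (pos_of_mem_metaDomain hS.T_pos hs.p_mem (.inr v))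
    linarith [metaBound_noLoop_sub_le hS hc hs h]
  le_add s Y W loss x hs hl h := by
    have hround := hs.dotProduct_metaEst_le hS hl x (.inr v)
    have hv : noLoopLoss (metaEst C loss s x) (.inr v) = armEst C v loss s x := rfl
    linarith [metaBound_noLoop_sub_le hS hc hs h]

end Epoch

/-! ### Epochs compared to an arm in a clique -/

section Clique

variable {K κ T : ℕ} {G : Digraph (Fin K)} {C : Fin κ → Finset (Fin K)} {c η : ℝ} {s : State G κ}
  {loss : Fin K → ℝ} {x : Choice G κ} {j : Fin κ} {i : Fin K}

/-- The point mass at the arm `i`, mixed with the uniform distribution on `C` so as to lie in the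
decision set of Hedge. -/
def hedgeComparator (T : ℕ) (C : Finset (Fin K)) (i : Fin K) : Fin K → ℝ :=
  fun i' => (if i' = i then 1 - 1 / (T : ℝ) else 0) + 1 / T * (hedgeInit C).prob i'

lemma hedgeComparator_mem {C : Finset (Fin K)} (hT : 0 < T) (hi : i ∈ C) :
    hedgeComparator T C i ∈ hedgeDomain T C := by
  have hunif := hedgeInit_mem hT ⟨i, hi⟩
  have hT1 : 1 / (T : ℝ) ≤ 1 := (div_le_one (by positivity)).2 (by exact_mod_cast hT)
  have hge : ∀ i', 1 / T * (hedgeInit C).prob i' ≤ hedgeComparator T C i i' := fun i' => by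
    unfold hedgeComparator
    split_ifs <;> linarith
  refine ⟨⟨fun i' => le_trans (mul_nonneg (by positivity) (hunif.1.1 i')) (hge i'), ?_⟩,
    fun i' hi' => ?_, fun i' hi' => ?_⟩
  · simp only [hedgeComparator, sum_add_distrib, sum_ite_eq', mem_univ, if_true, ← mul_sum,
      hunif.1.2]
    ring
  · refine le_trans ?_ (hge i')
    simp only [hedgeInit, hi', if_true]
    rw [mul_comm, ← one_div_mul_one_div]
  · have hne : i' ≠ i := fun h => hi' (h ▸ hi)
    simp [hedgeComparator, hne, hunif.2.2 i' hi']

lemma hedgeComparator_dotProduct_le (C : Finset (Fin K)) (i : Fin K) {g : Fin K → ℝ}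
    (hg : ∀ i, 0 ≤ g i) :
    hedgeComparator T C i ⬝ᵥ g ≤ g i + 1 / T * ((hedgeInit C).prob ⬝ᵥ g) := by
  calc hedgeComparator T C i ⬝ᵥ g
      = (1 - 1 / (T : ℝ)) * g i + 1 / T * ((hedgeInit C).prob ⬝ᵥ g) := by
        simp only [hedgeComparator, dotProduct, add_mul, sum_add_distrib, mul_sum, ite_mul,
          zero_mul, sum_ite_eq', mem_univ, if_true, mul_assoc]
    _ ≤ _ := by
        gcongr
        exact mul_le_of_le_one_left (hg i) (sub_le_self _ (by positivity))

/-- The excess over its threshold that the inverse of the probability of a clique may have at the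
restart. -/
def startBound (T : ℕ) (G : Digraph (Fin K)) (κ : ℕ) (c η : ℝ) : ℝ :=
  4 * (η * (epochScale G κ c η * log T) + 1)

lemma inv_restart_le (hS : Setting T G C) (hc : 0 ≤ c) (hη : 0 < η) (j : Fin κ) :
    1 / (restart T G C c η).p (.inl j) ≤ startBound T G κ c η := by
  obtain ⟨hp, hdiv⟩ := restart_div_le hS.T_pos hη hc ⟨_, metaComparator_mem hS (.inl j)⟩
  have hp0 := pos_of_mem_metaDomain hS.T_pos hp
  have hu := metaComparator_mem hS (.inl j)
  have hcoord := (hybridCoordDiv_le_hybridDiv (c := c) (rate := fun _ : Fin κ => η) hη hc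
    (fun _ => hη) (pos_of_mem_metaDomain hS.T_pos hu) hp0 (.inl j)).trans (hdiv _ hu)
  have hgap := inv_sub_log_two_le_barrierGap (half_le_metaComparator hS (.inl j)) (hp0 (.inl j))
  simp only [hybridCoordDiv] at hcoord
  rw [one_div, inv_mul_le_iff₀ hη] at hcoord
  simp only [restart, startBound, epochScale]
  linarith [log_two_lt_d9]

lemma State.Valid.startBound_nonneg (hS : Setting T G C) (hc : 0 ≤ c) (hs : s.Valid T C) :
    0 ≤ startBound T G κ c s.eta := by
  have hscale := hs.one_le_epochScale hS hc
  have hlog := hS.one_le_log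
  have hη := hs.eta_pos
  unfold startBound
  positivity

/-- The invariant of an epoch compared to the arm `i` in clique `j`: here `X` is the loss of the
Hedge instance `j`, `W₁` is the excess loss of the comparator of the meta-algorithm, and `U` bounds
the loss of the comparator of Hedge. -/
structure CliqueInv (T : ℕ) (C : Fin κ → Finset (Fin K)) (c : ℝ) (j : Fin κ) (i : Fin K)
    (s : State G κ) (X W₁ U : ℝ) : Prop where
  meta_bound : MetaBound T c (.inl j) s (X + W₁)
  hedge_bound : HedgeBound T (hedgeComparator T (C j) i) (s.hedge j) X U
  loss_nonneg : 0 ≤ X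
  excess_nonneg : 0 ≤ W₁
  sqSum_le : (s.hedge j).sqSum ≤ (s.rho j + startBound T G κ c s.eta) * X
  inv_le : 1 / s.p (.inl j) ≤ s.rho j + startBound T G κ c s.eta

lemma cliqueInv_restart (hS : Setting T G C) (hc : 0 ≤ c) (hη : 0 < η) (hi : i ∈ C j) :
    CliqueInv T C c j i (restart T G C c η) 0 0 0 where
  meta_bound := by
    rw [add_zero]
    exact metaBound_restart hS hc hη _
  hedge_bound := hedgeBound_init hS.T_pos (hS.partition.nonempty j)
    (hedgeComparator_mem hS.T_pos hi)
  loss_nonneg := le_rfl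
  excess_nonneg := le_rfl
  sqSum_le := by simp [restart, hedgeInit]
  inv_le := (inv_restart_le hS hc hη j).trans (le_add_of_nonneg_left (by simp [restart]))

/-- The estimates of the arms in clique `j` are at most the inverse of its probability. -/
lemma State.Valid.sum_prob_mul_sq_le (hS : Setting T G C) (hs : s.Valid T C)
    (hl : ∀ i, loss i ∈ Set.Icc (0 : ℝ) 1) (j : Fin κ) :
    ∑ i, (s.hedge j).prob i * armEstimator C s x (feedback G loss x.2) i ^ 2
      ≤ 1 / s.p (.inl j) * metaEst C loss s x (.inl j) := by
  classical
  have hmem := (hs.hedge_valid j).prob_mem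
  simp only [metaEst, metaEstimator, dotProduct, mul_sum]
  refine sum_le_sum fun i' _ => ?_
  by_cases hi' : i' ∈ C j
  · have hest : armEstimator C s x (feedback G loss x.2) i' ≤ 1 / s.p (.inl j) := by
      rw [le_div_iff₀ (pos_of_mem_metaDomain hS.T_pos hs.p_mem _), mul_comm]
      exact (mul_armEstimator_le hS.partition hl hi').trans (by split_ifs <;> norm_num)
    have hnonneg := armEstimator_nonneg (x := x) hS.partition hs.p_mem hl i'
    linarith [mul_le_mul_of_nonneg_left hest (mul_nonneg (hmem.1.1 i') hnonneg)]
  · simp [hmem.2.2 i' hi']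

lemma State.Valid.rho_advance (hS : Setting T G C) (hc : 4 ≤ c) (hs : s.Valid T C)
    (hl : ∀ i, loss i ∈ Set.Icc (0 : ℝ) 1) (x : Choice G κ) (j : Fin κ) :
    s.rho j ≤ (advance T G C c loss s x).rho j ∧
      1 / (advance T G C c loss s x).p (.inl j) ≤ (advance T G C c loss s x).rho j := by
  have hinv := one_div_pos.2 (pos_of_mem_metaDomain hS.T_pos (hs.omdStep hS hc hl x).1 (.inl j))
  simp only [advance] at hinv ⊢
  split_ifs with hρ
  · rw [div_eq_mul_one_div 2]
    constructor <;> linarith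
  · exact ⟨le_rfl, not_lt.1 hρ⟩

lemma CliqueInv.advance (hS : Setting T G C) (hc : 4 ≤ c) (hs : s.Valid T C)
    (hl : ∀ i, loss i ∈ Set.Icc (0 : ℝ) 1) (hi : i ∈ C j) {X W₁ U : ℝ}
    (h : CliqueInv T C c j i s X W₁ U) :
    CliqueInv T C c j i (advance T G C c loss s x) (X + metaEst C loss s x (.inl j))
      (W₁ + 1 / T * ∑ m, metaEst C loss s x m)
      (U + armEst C i loss s x
        + 1 / T * ((hedgeInit (C j)).prob ⬝ᵥ armEstimator C s x (feedback G loss x.2))) := by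
  have hnonneg := (hs.lossBound hS hl x).nonneg
  have hest := armEstimator_nonneg (x := x) hS.partition hs.p_mem hl
  have hX := h.loss_nonneg
  have hW₁ := h.excess_nonneg
  have hmeta := metaComparator_dotProduct_le (T := T) (.inl j) hnonneg
  have hhedge := hedgeComparator_dotProduct_le (T := T) (C j) i hest
  have hstart := hs.startBound_nonneg hS (c := c) (by linarith)
  have hρ := hs.rho_advance hS hc hl x j
  have hρ' : s.rho j + startBound T G κ c s.eta
      ≤ (GraphBandit.advance T G C c loss s x).rho j + startBound T G κ c s.eta := by
    linarith [hρ.1]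
  exact {
    meta_bound := (h.meta_bound.advance hS hc hs hl x).mono (by linarith)
    hedge_bound := (h.hedge_bound.hedgeStep hS.T_pos (hedgeComparator_mem hS.T_pos hi)
      (hs.hedge_valid j) hest).mono (by linarith)
    loss_nonneg := add_nonneg hX (hnonneg _)
    excess_nonneg := add_nonneg hW₁ <| mul_nonneg (by positivity) <|
      sum_nonneg fun m _ => hnonneg m
    sqSum_le :=
      calc _ ≤ (s.rho j + startBound T G κ c s.eta) * X
            + 1 / s.p (.inl j) * metaEst C loss s x (.inl j) :=
          add_le_add h.sqSum_le (hs.sum_prob_mul_sq_le hS hl j)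
        _ ≤ (s.rho j + startBound T G κ c s.eta) * X
            + (s.rho j + startBound T G κ c s.eta) * metaEst C loss s x (.inl j) := by
          gcongr
          exacts [hnonneg _, h.inv_le]
        _ ≤ _ := by
          rw [← mul_add]
          exact mul_le_mul_of_nonneg_right hρ' (add_nonneg hX (hnonneg _))
    inv_le := hρ.2.trans (le_add_of_nonneg_right hstart) }

lemma mul_sqrt_one_add_le {a ρ X V L : ℝ} (ha : 0 < a) (hρ : 0 ≤ ρ) (hX : 0 ≤ X)
    (hV : V ≤ ρ * X) (hL : 2 ≤ L) :
    (L + 4) * √(1 + V) ≤ 3 * L + ρ / (160 * a) + 360 * L ^ 2 * a * X := by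
  have hsqrt : √(1 + V) ≤ 1 + √(ρ * X) := by
    refine sqrt_le_iff.2 ⟨by positivity, ?_⟩
    nlinarith [sq_sqrt (show 0 ≤ ρ * X by positivity), sqrt_nonneg (ρ * X)]
  have hamgm : 3 * L * √(ρ * X) ≤ ρ / (160 * a) + 360 * L ^ 2 * a * X := by
    refine (abs_le_of_sq_le_sq' ?_ (by positivity)).2
    calc (3 * L * √(ρ * X)) ^ 2 = 4 * (ρ / (160 * a)) * (360 * L ^ 2 * a * X) := by
          rw [mul_pow, sq_sqrt (by positivity)]
          field_simp
          ring
      _ ≤ _ := by linarith [sq_nonneg (ρ / (160 * a) - 360 * L ^ 2 * a * X)]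
  calc (L + 4) * √(1 + V) ≤ 3 * L * √(1 + V) := by gcongr; linarith
    _ ≤ 3 * L * (1 + √(ρ * X)) := by gcongr
    _ ≤ _ := by linarith

lemma startBound_div_le (hS : Setting T G C) (hc : 0 ≤ c) (hs : s.Valid T C) :
    startBound T G κ c s.eta / (160 * (s.eta * log T)) ≤ epochScale G κ c s.eta := by
  have hη := hs.eta_pos
  have hlog := hS.one_le_log
  have hscale := hs.one_le_epochScale hS hc
  have hinv : 1 / s.eta * (1 / log T) ≤ 1 / s.eta :=
    mul_le_of_le_one_right (by positivity) ((div_le_one (by linarith)).2 hlog)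
  calc startBound T G κ c s.eta / (160 * (s.eta * log T))
      = (epochScale G κ c s.eta + 1 / s.eta * (1 / log T)) / 40 := by
        unfold startBound
        field_simp
        ring
    _ ≤ _ := by linarith [one_div_le_epochScale (G := G) (κ := κ) hc hη]

lemma CliqueInv.hedge_regret_le (hS : Setting T G C) (hc : 0 ≤ c) (hs : s.Valid T C)
    (hi : i ∈ C j) {X W₁ U : ℝ} (h : CliqueInv T C c j i s X W₁ U) :
    X - U ≤ rhoGain T s (.inl j) / 2 + epochScale G κ c s.eta + 3 * log (K * T)
      + 360 * log (K * T) ^ 2 * (s.eta * log T) * X := by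
  have hη := hs.eta_pos
  have hlog := hS.one_le_log
  have hρ : 0 ≤ s.rho j + startBound T G κ c s.eta := by
    linarith [(hs.rate_valid j).two_le_rho, hs.startBound_nonneg hS hc]
  have hsqrt := mul_sqrt_one_add_le (a := s.eta * log T) (by positivity) hρ h.loss_nonneg
    h.sqSum_le hS.two_le_log
  rw [add_div] at hsqrt
  have hgain : s.rho j / (160 * (s.eta * log T)) = rhoGain T s (.inl j) / 2 := by
    rw [rhoGain, div_div]
    ring
  linarith [h.hedge_bound.sub_le (hedgeComparator_mem hS.T_pos hi).1.1 (hs.hedge_valid j),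
    startBound_div_le hS hc hs]

lemma epoch_constants_le {S l L : ℝ} (hS : 1 ≤ S) (hL : 2 ≤ L) (hlL : l ≤ L) :
    (2 * l + 48) * S + 3 * L + 1 + 720 * L ^ 2 * l * S ≤ 800 * L ^ 3 * S := by
  have hlin : 2 * l * S ≤ 2 * L * S := by gcongr
  have hcub : 720 * L ^ 2 * l * S ≤ 720 * L ^ 2 * L * S := by gcongr
  have hLS : 3 * L ≤ 3 * L * S := le_mul_of_one_le_right (by linarith) hS
  have hgap : 0 ≤ L * S * (L ^ 2 - 4) := mul_nonneg (by positivity) (by nlinarith)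
  have hgap' : 0 ≤ S * (L - 2) := mul_nonneg (by linarith) (by linarith)
  linarith

lemma CliqueInv.regret_le (hS : Setting T G C) (hc : 8 ≤ c) (hs : s.Valid T C) (hi : i ∈ C j)
    {X W₁ U : ℝ} (h : CliqueInv T C c j i s X W₁ U) :
    s.cumLoss - (U + W₁) + 1 / s.p (.inl j) + 1
      ≤ 800 * log (K * T) ^ 3 * epochScale G κ c s.eta := by
  have hc0 : 0 ≤ c := by linarith
  have hη := hs.eta_pos
  have hlog := hS.one_le_log
  have hscale := hs.one_le_epochScale hS hc0
  have hconst := epoch_constants_le hscale hS.two_le_log hS.log_le_log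
  have hmeta := h.meta_bound.sub_le hS hc hs
  have hhedge := h.hedge_regret_le hS hc0 hs hi
  have hgain : 0 ≤ rhoGain T s (.inl j) := by
    have := (hs.rate_valid j).two_le_rho
    simp only [rhoGain]
    positivity
  have hinv := one_div_pos.2 (pos_of_mem_metaDomain hS.T_pos hs.p_mem (.inl j))
  have hW₁ := h.excess_nonneg
  rcases le_total X (2 * s.cumLoss) with hX | hX
  · have hterm : 360 * log (K * T) ^ 2 * (s.eta * log T) * X
        ≤ 720 * log (K * T) ^ 2 * log T * epochScale G κ c s.eta :=
      calc _ ≤ 360 * log (K * T) ^ 2 * (s.eta * log T) * (2 * s.cumLoss) := by gcongr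
        _ = 720 * log (K * T) ^ 2 * log T * (s.eta * s.cumLoss) := by ring
        _ ≤ _ := by
          gcongr
          exact hs.eta_mul_cumLoss_le hc0
    linarith
  · -- The loss of Hedge dominates, so half of the bound for the meta-algorithm suffices.
    have hterm : 360 * log (K * T) ^ 2 * (s.eta * log T) * X ≤ 1 / 4 * X := by
      gcongr
      · exact h.loss_nonneg
      · linarith [hs.eta_le]
    have hcub : 0 ≤ 720 * log (K * T) ^ 2 * log T * epochScale G κ c s.eta := by positivity
    have hlin : 0 ≤ epochScale G κ c s.eta * log T := by positivity
    linarith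

lemma epochBound_clique (hS : Setting T G C) (hc : 8 ≤ c) (hi : i ∈ C j) :
    EpochBound (G := G) T C c (800 * log (K * T) ^ 3) i (hedgeInit (C j)).prob
      fun s Y W => ∃ X W₁, CliqueInv T C c j i s X W₁ (Y + (W - W₁)) where
  start η hη := by
    refine ⟨0, 0, ?_⟩
    simp only [sub_zero, add_zero]
    exact cliqueInv_restart hS (by linarith) hη hi
  advance s Y W loss x hs hl := by
    rintro ⟨X, W₁, h⟩
    refine ⟨X + metaEst C loss s x (.inl j), W₁ + 1 / T * ∑ m, metaEst C loss s x m, ?_⟩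
    convert h.advance (x := x) hS (by linarith) hs hl hi using 1
    unfold slack
    ring
  le s Y W hs := by
    rintro ⟨X, W₁, h⟩
    have hinv := one_div_pos.2 (pos_of_mem_metaDomain hS.T_pos hs.p_mem (.inl j))
    linarith [h.regret_le hS hc hs hi]
  le_add s Y W loss x hs hl := by
    rintro ⟨X, W₁, h⟩
    have hround := hs.dotProduct_metaEst_le hS hl x (.inl j)
    have hest := armEstimator_nonneg (x := x) hS.partition hs.p_mem hl i
    simp only [noLoopLoss] at hround
    linarith [h.regret_le hS hc hs hi]

end Clique

/-! ### All epochs together -/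

section Run

variable {K κ T : ℕ} {G : Digraph (Fin K)} {C : Fin κ → Finset (Fin K)} {c Q η₁ : ℝ}
  {s : State G κ} {loss mix : Fin K → ℝ} {i : Fin K} {P : State G κ → ℝ → ℝ → Prop}
  {Z Y W Yc Wc : ℝ}

lemma State.Valid.slack_nonneg (hS : Setting T G C) (hs : s.Valid T C)
    (hl : ∀ i, loss i ∈ Set.Icc (0 : ℝ) 1) (hmix : ∀ i, 0 ≤ mix i) (x : Choice G κ) :
    0 ≤ slack T C mix loss s x :=
  mul_nonneg (by positivity) <| add_nonneg
    (sum_nonneg fun m _ => (hs.lossBound hS hl x).nonneg m)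
    (dotProduct_nonneg_of_nonneg hmix (armEstimator_nonneg hS.partition hs.p_mem hl))

lemma State.Valid.metaEst_le (hS : Setting T G C) (hs : s.Valid T C)
    (hl : ∀ i, loss i ∈ Set.Icc (0 : ℝ) 1) (x : Choice G κ) (m : Meta G κ) :
    metaEst C loss s x m ≤ T := by
  have hloss := hs.lossBound hS hl x
  have hT : (0 : ℝ) < T := by exact_mod_cast hS.T_pos
  have hle : ∀ {q : ℝ}, 1 / (T : ℝ) ≤ q → q * metaEst C loss s x m ≤ 1 →
      metaEst C loss s x m ≤ T := fun {q} hq h => by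
    have hmul := (mul_le_mul_of_nonneg_right hq (hloss.nonneg m)).trans h
    rw [one_div, inv_mul_le_iff₀ hT] at hmul
    linarith
  rcases m with j | v
  · exact hle (hs.p_mem.2 _) (hloss.clique j)
  · obtain ⟨m, hm⟩ := hS.exists_ne_noLoop v
    exact hle (by linarith [add_le_one_of_mem_metaDomain hs.p_mem hm, hs.p_mem.2 m])
      (hloss.noLoop v)

lemma State.Valid.dotProduct_metaEst_le_horizon (hS : Setting T G C) (hs : s.Valid T C)
    (hl : ∀ i, loss i ∈ Set.Icc (0 : ℝ) 1) (x : Choice G κ) :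
    s.p ⬝ᵥ metaEst C loss s x ≤ T :=
  calc s.p ⬝ᵥ metaEst C loss s x ≤ ∑ m, s.p m * T :=
        sum_le_sum fun m _ => mul_le_mul_of_nonneg_left (hs.metaEst_le hS hl x m) (hs.p_mem.1.1 m)
    _ = T := by rw [← sum_mul, hs.p_mem.1.2, one_mul]

/-- The sum of the scales of the epochs that precede the one with learning rate `η`, when the
initial learning rate is `η₁` and is halved at each restart. -/
def pastScale (G : Digraph (Fin K)) (κ : ℕ) (c η₁ η : ℝ) : ℝ :=
  (κ + 1) * (1 / η - 1 / η₁) + c * metaCard G κ * logb 2 (η₁ / η)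

lemma pastScale_self (hη₁ : 0 < η₁) : pastScale G κ c η₁ η₁ = 0 := by
  simp [pastScale, hη₁.ne']

lemma pastScale_half {η : ℝ} (hη₁ : 0 < η₁) (hη : 0 < η) :
    pastScale G κ c η₁ (η / 2) = pastScale G κ c η₁ η + epochScale G κ c η := by
  have hlog : logb 2 (η₁ / (η / 2)) = logb 2 (η₁ / η) + 1 := by
    rw [div_div_eq_mul_div, mul_div_right_comm, logb_mul (by positivity) two_ne_zero,
      logb_self_eq_one one_lt_two]
  rw [pastScale, pastScale, epochScale, hlog, one_div_div]
  ring

/-- The progress of the algorithm over all epochs: `Z` is its estimated loss, `Y` that of the arm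
it is compared to, and `W` the slack. The parts of `Y` and `W` from the current epoch are `Yc` and
`Wc`. -/
structure RunInv (c Q η₁ : ℝ) (P : State G κ → ℝ → ℝ → Prop) (s : State G κ)
    (Z Y W Yc Wc : ℝ) : Prop where
  current : P s Yc Wc
  past_le : (Z - s.cumLoss) - (Y - Yc) ≤ Q * pastScale G κ c η₁ s.eta + (W - Wc)
  cumLoss_le : s.cumLoss ≤ Z
  eta_or : s.eta = η₁ ∨ (κ + 1) / s.eta ^ 2 ≤ 4 * (Z - s.cumLoss)

lemma runInv_restart (hP : EpochBound T C c Q i mix P) (hη₁ : 0 < η₁) :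
    RunInv c Q η₁ P (restart T G C c η₁) 0 0 0 0 0 where
  current := hP.start η₁ hη₁
  past_le := by simp [restart, pastScale_self hη₁]
  cumLoss_le := le_rfl
  eta_or := .inl rfl

lemma RunInv.restart (hS : Setting T G C) (hP : EpochBound T C c Q i mix P) (hη₁ : 0 < η₁)
    (hmix : ∀ i, 0 ≤ mix i) (hs : s.Valid T C) (hl : ∀ i, loss i ∈ Set.Icc (0 : ℝ) 1)
    {x : Choice G κ} (h : RunInv c Q η₁ P s Z Y W Yc Wc)
    (hrestart : (κ + 1) / s.eta ≤ s.eta * (s.cumLoss + s.p ⬝ᵥ metaEst C loss s x)) :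
    RunInv c Q η₁ P (restart T G C c (s.eta / 2)) (Z + s.p ⬝ᵥ metaEst C loss s x)
      (Y + armEst C i loss s x) (W + slack T C mix loss s x) 0 0 where
  current := hP.start _ (half_pos hs.eta_pos)
  past_le := by
    have hlast := hP.le_add s _ _ loss x hs hl h.current
    have hslack := hs.slack_nonneg hS hl hmix x
    simp only [GraphBandit.restart, pastScale_half hη₁ hs.eta_pos]
    linarith [h.past_le]
  cumLoss_le :=
    add_nonneg (hs.cumLoss_nonneg.trans h.cumLoss_le) (hs.dotProduct_metaEst_nonneg hS hl x)
  eta_or := .inr <| by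
    have hη := hs.eta_pos
    have hcum : (κ + 1) / s.eta / s.eta ≤ s.cumLoss + s.p ⬝ᵥ metaEst C loss s x := by
      rwa [div_le_iff₀' hη]
    calc (κ + 1) / (s.eta / 2) ^ 2 = 4 * ((κ + 1) / s.eta / s.eta) := by field_simp; norm_num
      _ ≤ 4 * (Z + s.p ⬝ᵥ metaEst C loss s x - 0) := by linarith [h.cumLoss_le]

lemma RunInv.advance (hP : EpochBound T C c Q i mix P) (hs : s.Valid T C)
    (hl : ∀ i, loss i ∈ Set.Icc (0 : ℝ) 1) {x : Choice G κ}
    (h : RunInv c Q η₁ P s Z Y W Yc Wc) :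
    RunInv c Q η₁ P (advance T G C c loss s x) (Z + s.p ⬝ᵥ metaEst C loss s x)
      (Y + armEst C i loss s x) (W + slack T C mix loss s x) (Yc + armEst C i loss s x)
      (Wc + slack T C mix loss s x) where
  current := hP.advance s _ _ loss x hs hl h.current
  past_le := by
    simp only [GraphBandit.advance]
    linarith [h.past_le]
  cumLoss_le := by
    simp only [GraphBandit.advance]
    linarith [h.cumLoss_le]
  eta_or := by
    simp only [GraphBandit.advance, add_sub_add_right_eq_sub]
    exact h.eta_or

lemma RunInv.step (hS : Setting T G C) (hP : EpochBound T C c Q i mix P) (hη₁ : 0 < η₁)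
    (hmix : ∀ i, 0 ≤ mix i) (hs : s.Valid T C) (hl : ∀ i, loss i ∈ Set.Icc (0 : ℝ) 1)
    (x : Choice G κ) (h : RunInv c Q η₁ P s Z Y W Yc Wc) :
    ∃ Yc Wc, RunInv c Q η₁ P (step T G C c loss s x) (Z + s.p ⬝ᵥ metaEst C loss s x)
      (Y + armEst C i loss s x) (W + slack T C mix loss s x) Yc Wc := by
  classical
  rw [step_eq]
  split_ifs with hrestart
  · exact ⟨_, _, h.restart hS hP hη₁ hmix hs hl hrestart⟩
  · exact ⟨_, _, h.advance hP hs hl⟩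

lemma RunInv.div_eta_le (hη₁ : 0 < η₁) (hs : s.Valid T C) (h : RunInv c Q η₁ P s Z Y W Yc Wc) :
    (κ + 1) / s.eta ≤ (κ + 1) / η₁ + 2 * √((κ + 1) * Z) := by
  have hη := hs.eta_pos
  rcases h.eta_or with heta | heta
  · rw [heta]
    linarith [sqrt_nonneg ((κ + 1) * Z)]
  · have hsq : ((κ + 1) / s.eta / 2) ^ 2 ≤ (κ + 1) * Z :=
      calc ((κ + 1) / s.eta / 2) ^ 2 = (κ + 1) * ((κ + 1) / s.eta ^ 2 / 4) := by
            field_simp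
            norm_num
        _ ≤ (κ + 1) * Z := by
          gcongr
          linarith [hs.cumLoss_nonneg]
    have : 0 ≤ (κ + 1) / η₁ := by positivity
    linarith [le_sqrt_of_sq_le hsq]

lemma RunInv.one_add_logb_le (hS : Setting T G C) (hη₁ : 0 < η₁) (hη₁1 : η₁ ≤ 1)
    (hs : s.Valid T C) (h : RunInv c Q η₁ P s Z Y W Yc Wc) (hZ : Z ≤ T ^ 2) :
    1 + logb 2 (η₁ / s.eta) ≤ 4 * log (K * T) := by
  have hη := hs.eta_pos
  have hlog := hS.one_le_log
  have hT := hS.four_le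
  suffices hratio : η₁ / s.eta ≤ T ^ 2 by
    have hlogs := log_le_log (by positivity) hratio
    rw [log_pow, Nat.cast_ofNat] at hlogs
    have hlogb : logb 2 (η₁ / s.eta) ≤ 3 * log T := by
      rw [logb, div_le_iff₀ (log_pos one_lt_two)]
      nlinarith [log_two_gt_d9]
    linarith [hS.log_le_log]
  rcases h.eta_or with heta | heta
  · rw [heta, div_self hη₁.ne']
    nlinarith
  · have hsq : (η₁ / s.eta) ^ 2 ≤ (T ^ 2 : ℝ) ^ 2 :=
      calc (η₁ / s.eta) ^ 2 = η₁ ^ 2 / s.eta ^ 2 := div_pow ..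
        _ ≤ (κ + 1) / s.eta ^ 2 := by
          gcongr
          nlinarith [Nat.cast_nonneg (α := ℝ) κ]
        _ ≤ 4 * T ^ 2 := by linarith [hs.cumLoss_nonneg]
        _ ≤ (T ^ 2 : ℝ) ^ 2 := by
          rw [sq ((T : ℝ) ^ 2)]
          gcongr
          nlinarith
    exact le_of_sq_le_sq hsq (by positivity)

lemma pastScale_add_epochScale (η : ℝ) :
    pastScale G κ c η₁ η + epochScale G κ c η
      = 2 * ((κ + 1) / η) - (κ + 1) / η₁ + c * metaCard G κ * (1 + logb 2 (η₁ / η)) := by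
  unfold pastScale epochScale
  ring

lemma RunInv.regret_le (hS : Setting T G C) (hP : EpochBound T C c Q i mix P) (hQ : 0 ≤ Q)
    (hc : 0 ≤ c) (hη₁ : 0 < η₁) (hη₁1 : η₁ ≤ 1) (hs : s.Valid T C)
    (h : RunInv c Q η₁ P s Z Y W Yc Wc) (hZ : Z ≤ T ^ 2) :
    Z - Y ≤ Q * ((κ + 1) / η₁ + 4 * √((κ + 1) * Z)
      + 4 * (c * metaCard G κ * log (K * T))) + W := by
  have hlogb := mul_le_mul_of_nonneg_left (h.one_add_logb_le hS hη₁ hη₁1 hs hZ)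
    (by positivity : 0 ≤ c * metaCard G κ)
  have hscale : pastScale G κ c η₁ s.eta + epochScale G κ c s.eta
      ≤ (κ + 1) / η₁ + 4 * √((κ + 1) * Z) + 4 * (c * metaCard G κ * log (K * T)) := by
    rw [pastScale_add_epochScale]
    linarith [h.div_eta_le hη₁ hs]
  linarith [hP.le s _ _ hs h.current, h.past_le, mul_le_mul_of_nonneg_left hscale hQ]

end Run

/-! ### Expectations in a round -/

section RoundMean

variable {K κ T : ℕ} {G : Digraph (Fin K)} {C : Fin κ → Finset (Fin K)} {s : State G κ}
  {loss mix : Fin K → ℝ}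

/-- The expectation of `F` over the choices of a round that begins in state `s`. -/
def roundMean (s : State G κ) (F : Choice G κ → ℝ) : ℝ := ∑ x, choiceProb s x * F x

lemma roundMean_eq (F : Choice G κ → ℝ) :
    roundMean s F = ∑ j : Fin κ, s.p (.inl j) * ∑ a, (s.hedge j).prob a * F (.inl j, a)
      + ∑ v : NoLoop G, s.p (.inr v) * F (.inr v, v) := by
  rw [roundMean, Fintype.sum_prod_type, Fintype.sum_sum_type]
  congr 1
  · simp only [choiceProb, mul_sum, mul_assoc]
  · simp [choiceProb, ite_mul]

lemma roundMean_add (F F' : Choice G κ → ℝ) :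
    roundMean s (fun x => F x + F' x) = roundMean s F + roundMean s F' := by
  simp only [roundMean, mul_add, sum_add_distrib]

lemma roundMean_mul_left (a : ℝ) (F : Choice G κ → ℝ) :
    roundMean s (fun x => a * F x) = a * roundMean s F := by
  simp only [roundMean, mul_sum, mul_left_comm]

lemma roundMean_sum {ι : Type*} (t : Finset ι) (F : ι → Choice G κ → ℝ) :
    roundMean s (fun x => ∑ k ∈ t, F k x) = ∑ k ∈ t, roundMean s (F k) := by
  simp only [roundMean, mul_sum]
  exact sum_comm

/-- The arms that may be pulled when the meta-node `m` is drawn. -/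
def metaArms (C : Fin κ → Finset (Fin K)) : Meta G κ → Finset (Fin K)
  | .inl j => C j
  | .inr v => {v.1}

namespace State.Valid

variable (hs : s.Valid T C)

include hs

lemma choiceProb_nonneg (x : Choice G κ) : 0 ≤ choiceProb s x := by
  obtain ⟨j | v, a⟩ := x
  · exact mul_nonneg (hs.p_mem.1.1 _) ((hs.hedge_valid j).prob_mem.1.1 a)
  · simp only [choiceProb]
    split_ifs
    · exact hs.p_mem.1.1 _
    · exact le_rfl

lemma choiceProb_eq_zero {x : Choice G κ} (hx : x.2 ∉ metaArms C x.1) : choiceProb s x = 0 := by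
  obtain ⟨j | v, a⟩ := x
  · simp only [choiceProb, (hs.hedge_valid j).prob_mem.2.2 a hx, mul_zero]
  · exact if_neg (by simpa [metaArms] using hx)

lemma roundMean_congr {F F' : Choice G κ → ℝ} (h : ∀ x, x.2 ∈ metaArms C x.1 → F x = F' x) :
    roundMean s F = roundMean s F' :=
  sum_congr rfl fun x _ => by
    by_cases hx : x.2 ∈ metaArms C x.1
    · rw [h x hx]
    · rw [hs.choiceProb_eq_zero hx, zero_mul, zero_mul]

lemma roundMean_fst (F : Meta G κ → ℝ) : roundMean s (fun x => F x.1) = ∑ m, s.p m * F m := by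
  rw [roundMean_eq, Fintype.sum_sum_type]
  simp only [← sum_mul, (hs.hedge_valid _).prob_mem.1.2, one_mul]

lemma roundMean_const (a : ℝ) : roundMean s (fun _ => a) = a := by
  rw [hs.roundMean_fst fun _ => a, ← sum_mul, hs.p_mem.1.2, one_mul]

lemma roundMean_armEst_of_mem (hS : Setting T G C) {i : Fin K} {j : Fin κ} (hi : i ∈ C j) :
    roundMean s (armEst C i loss s) = loss i := by
  classical
  have hobserved : ∀ a ∈ C j, a ∈ inNbrs G i := fun a ha => by
    by_cases hai : a = i
    · exact hai ▸ hS.partition.mem_inNbrs ha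
    · exact hS.partition.clique j a ha i hi hai
  calc roundMean s (armEst C i loss s)
      = roundMean s fun x => if x.1 = .inl j then loss i / s.p (.inl j) else 0 :=
        hs.roundMean_congr fun ⟨m, a⟩ ha => by
          rw [armEst, armEstimator_of_mem hS.partition _ hi]
          refine if_ctx_congr Iff.rfl (fun hm : m = .inl j => ?_) fun _ => rfl
          subst hm
          rw [feedback, if_pos (hobserved a ha)]
    _ = s.p (.inl j) * (loss i / s.p (.inl j)) := by
        rw [hs.roundMean_fst fun m => if m = .inl j then loss i / s.p (.inl j) else 0]
        simp only [mul_ite, mul_zero, sum_ite_eq', mem_univ, if_true]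
    _ = loss i := mul_div_cancel₀ _ (pos_of_mem_metaDomain hS.T_pos hs.p_mem _).ne'

lemma roundMean_armEst_noLoop (hS : Setting T G C) (v : NoLoop G) :
    roundMean s (armEst C v loss s) = loss v := by
  classical
  have hpos : 0 < 1 - s.p (.inr v) := by
    obtain ⟨m, hm⟩ := hS.exists_ne_noLoop v
    linarith [add_le_one_of_mem_metaDomain hs.p_mem hm,
      pos_of_mem_metaDomain hS.T_pos hs.p_mem m]
  have hobserved : ∀ a, (v : Fin K) ≠ a → a ∈ inNbrs G v := fun a ha => by
    rw [(hS.observable v).2.resolve_left v.2]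
    exact ha.symm
  have hdrawn : ∀ m : Meta G κ, ∀ a ∈ metaArms C m, (v : Fin K) = a ↔ m = .inr v := by
    rintro (j | v') a ha
    · exact iff_of_false (fun hva => v.2 (hva ▸ hS.partition.mem_inNbrs ha)) Sum.inl_ne_inr
    · rw [mem_singleton.1 ha, Sum.inr.injEq, Subtype.ext_iff, eq_comm]
  calc roundMean s (armEst C v loss s)
      = roundMean s fun x => loss v / (1 - s.p (.inr v))
          + -(if x.1 = .inr v then loss v / (1 - s.p (.inr v)) else 0) :=
        hs.roundMean_congr fun ⟨m, a⟩ ha => by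
          rw [armEst, armEstimator_noLoop]
          by_cases hva : (v : Fin K) = a
          · rw [if_neg (not_not.2 hva), if_pos ((hdrawn m a ha).1 hva), add_neg_cancel]
          · rw [if_pos hva, if_neg (mt (hdrawn m a ha).2 hva), feedback,
              if_pos (hobserved a hva), neg_zero, add_zero]
    _ = (1 - s.p (.inr v)) * (loss v / (1 - s.p (.inr v))) := by
        rw [roundMean_add, hs.roundMean_const,
          hs.roundMean_fst fun m => -(if m = .inr v then loss v / (1 - s.p (.inr v)) else 0)]
        simp only [mul_neg, mul_ite, mul_zero, sum_neg_distrib, sum_ite_eq', mem_univ, if_true]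
        ring
    _ = loss v := mul_div_cancel₀ _ hpos.ne'

variable (hS : Setting T G C)

include hS

lemma roundMean_armEst (i : Fin K) : roundMean s (armEst C i loss s) = loss i := by
  by_cases hi : i ∈ inNbrs G i
  · obtain ⟨j, hj⟩ := (hS.partition.covers i).2 hi
    exact hs.roundMean_armEst_of_mem hS hj
  · exact hs.roundMean_armEst_noLoop hS ⟨i, hi⟩

lemma roundMean_dotProduct_armEstimator (q : Fin K → ℝ) :
    roundMean s (fun x => q ⬝ᵥ armEstimator C s x (feedback G loss x.2)) = q ⬝ᵥ loss := by
  simp only [dotProduct]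
  rw [roundMean_sum]
  exact sum_congr rfl fun i _ => by rw [roundMean_mul_left, hs.roundMean_armEst hS]

lemma roundMean_metaEst (m : Meta G κ) :
    roundMean s (fun x => metaEst C loss s x m) = metaEstimator s loss m := by
  rcases m with j | v
  · exact hs.roundMean_dotProduct_armEstimator hS _
  · exact hs.roundMean_armEst hS v

lemma roundMean_dotProduct_metaEst :
    roundMean s (fun x => s.p ⬝ᵥ metaEst C loss s x) = roundMean s fun x => loss x.2 := by
  simp only [dotProduct]
  rw [roundMean_sum, roundMean_eq, Fintype.sum_sum_type]
  simp only [roundMean_mul_left, hs.roundMean_metaEst hS]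
  rfl

lemma roundMean_slack_le (hmix : ∀ i, 0 ≤ mix i) (hmix1 : ∑ i, mix i ≤ 1)
    (hl : ∀ i, loss i ≤ 1) :
    roundMean s (slack T C mix loss s) ≤ 1 / T * (metaCard G κ + 1) := by
  have haverage : ∀ q : Fin K → ℝ, (∀ i, 0 ≤ q i) → q ⬝ᵥ loss ≤ ∑ i, q i := fun q hq =>
    sum_le_sum fun i _ => mul_le_of_le_one_right (hq i) (hl i)
  have hmeta : ∀ m : Meta G κ, metaEstimator s loss m ≤ 1 := by
    rintro (j | v)
    · exact (hs.hedge_valid j).prob_mem.1.2 ▸ haverage _ (hs.hedge_valid j).prob_mem.1.1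
    · exact hl v
  calc roundMean s (slack T C mix loss s)
      = 1 / T * (∑ m : Meta G κ, metaEstimator s loss m + mix ⬝ᵥ loss) := by
        unfold slack
        simp only [roundMean_mul_left, roundMean_add, roundMean_sum,
          hs.roundMean_metaEst hS, hs.roundMean_dotProduct_armEstimator hS]
    _ ≤ 1 / T * (∑ _m : Meta G κ, 1 + 1) := by
        gcongr with m
        · exact hmeta m
        · exact (haverage mix hmix).trans hmix1
    _ = 1 / T * (metaCard G κ + 1) := by simp [metaCard]

end State.Valid

end RoundMean

/-! ### Expectations over a run -/

section RunMean

variable {K κ T n : ℕ} {G : Digraph (Fin K)} {C : Fin κ → Finset (Fin K)} {c η : ℝ}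
  {ℓ : ℕ → Fin K → ℝ} {f : ℕ → State G κ → Choice G κ → ℝ} {F F' : (Fin n → Choice G κ) → ℝ}

/-- The sum of `f t s x` over the first `n` rounds `t`, where `s` is the state at the beginning of
round `t` and `x` are the choices made in it. -/
def runSum (T : ℕ) (C : Fin κ → Finset (Fin K)) (c η : ℝ) (ℓ : ℕ → Fin K → ℝ)
    (f : ℕ → State G κ → Choice G κ → ℝ) : (n : ℕ) → (Fin n → Choice G κ) → ℝ
  | 0, _ => 0
  | n + 1, ω => runSum T C c η ℓ f n (Fin.init ω)
      + f n (stateAfter T G C c η ℓ n (Fin.init ω)) (ω (Fin.last n))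

/-- The expectation of `F` over the choices of the first `n` rounds. -/
def runMean (T : ℕ) (C : Fin κ → Finset (Fin K)) (c η : ℝ) (ℓ : ℕ → Fin K → ℝ)
    (n : ℕ) (F : (Fin n → Choice G κ) → ℝ) : ℝ :=
  ∑ ω, runProb T G C c η ℓ n ω * F ω

lemma runSum_eq_sum (g : ℕ → Choice G κ → ℝ) : ∀ (n : ℕ) (ω : Fin n → Choice G κ),
    runSum T C c η ℓ (fun t _ x => g t x) n ω = ∑ t : Fin n, g t (ω t)
  | 0, _ => by rw [runSum, Fin.sum_univ_zero]
  | n + 1, ω => by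
      rw [runSum, runSum_eq_sum g n, Fin.sum_univ_castSucc]
      rfl

lemma runMean_succ (F : (Fin (n + 1) → Choice G κ) → ℝ) :
    runMean T C c η ℓ (n + 1) F = runMean T C c η ℓ n fun ω =>
      roundMean (stateAfter T G C c η ℓ n ω) fun x =>
        F (Fin.snoc (α := fun _ => Choice G κ) ω x) := by
  unfold runMean roundMean
  rw [← (Fin.snocEquiv fun _ => Choice G κ).sum_comp, Fintype.sum_prod_type, sum_comm]
  refine sum_congr rfl fun ω _ => ?_
  rw [mul_sum]
  refine sum_congr rfl fun x _ => ?_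
  simp only [Fin.snocEquiv, Equiv.coe_fn_mk, runProb]
  rw [Fin.init_snoc (α := fun _ => Choice G κ), Fin.snoc_last (α := fun _ => Choice G κ),
    mul_assoc]

lemma runMean_add : runMean T C c η ℓ n (fun ω => F ω + F' ω)
    = runMean T C c η ℓ n F + runMean T C c η ℓ n F' := by
  simp only [runMean, mul_add, sum_add_distrib]

lemma runMean_mul_left (a : ℝ) :
    runMean T C c η ℓ n (fun ω => a * F ω) = a * runMean T C c η ℓ n F := by
  simp only [runMean, mul_sum, mul_left_comm]

lemma valid_stateAfter (hS : Setting T G C) (hc : 4 ≤ c) (hη : 0 < η)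
    (hη1 : η * (2000 * log T * log (K * T) ^ 2) ≤ 1)
    (hℓ : ∀ t < T, ∀ i, ℓ t i ∈ Set.Icc (0 : ℝ) 1) :
    ∀ n ≤ T, ∀ ω, (stateAfter T G C c η ℓ n ω).Valid T C
  | 0, _, _ => valid_restart hS (by linarith) hη hη1
  | n + 1, hn, ω => (valid_stateAfter hS hc hη hη1 hℓ n (by lia) (Fin.init ω)).step hS hc
      (hℓ n hn) _

section

variable (hv : ∀ n ≤ T, ∀ ω, (stateAfter T G C c η ℓ n ω).Valid T C)

include hv

lemma runProb_nonneg : ∀ n ≤ T, ∀ ω, 0 ≤ runProb T G C c η ℓ n ω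
  | 0, _, _ => zero_le_one
  | n + 1, hn, ω => mul_nonneg (runProb_nonneg n (by lia) (Fin.init ω))
      ((hv n (by lia) _).choiceProb_nonneg _)

lemma runMean_const (a : ℝ) : ∀ n ≤ T, runMean (G := G) T C c η ℓ n (fun _ => a) = a
  | 0, _ => by simp [runMean, runProb]
  | n + 1, hn => by
      simp only [runMean_succ, (hv n (by lia) _).roundMean_const]
      exact runMean_const a n (by lia)

lemma runMean_mono (hn : n ≤ T) (h : ∀ ω, F ω ≤ F' ω) :
    runMean T C c η ℓ n F ≤ runMean T C c η ℓ n F' :=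
  sum_le_sum fun ω _ => mul_le_mul_of_nonneg_left (h ω) (runProb_nonneg hv n hn ω)

lemma runMean_sqrt_le (hn : n ≤ T) (hF : ∀ ω, 0 ≤ F ω) :
    runMean T C c η ℓ n (fun ω => √(F ω)) ≤ √(runMean T C c η ℓ n F) :=
  strictConcaveOn_sqrt.concaveOn.le_map_sum (fun ω _ => runProb_nonneg hv n hn ω)
    (by simpa only [runMean, mul_one] using runMean_const hv 1 n hn) fun ω _ => hF ω

lemma runMean_runSum : ∀ n ≤ T, runMean T C c η ℓ n (runSum T C c η ℓ f n)
    = ∑ t ∈ range n, runMean T C c η ℓ t fun ω =>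
        roundMean (stateAfter T G C c η ℓ t ω) (f t (stateAfter T G C c η ℓ t ω))
  | 0, _ => by simp [runMean, runSum]
  | n + 1, hn => by
      rw [sum_range_succ, ← runMean_runSum n (by lia), ← runMean_add, runMean_succ]
      congr 1
      funext ω
      rw [← (hv n (by lia) ω).roundMean_const (runSum T C c η ℓ f n ω), ← roundMean_add]
      simp only [runSum, Fin.init_snoc (α := fun _ => Choice G κ),
        Fin.snoc_last (α := fun _ => Choice G κ)]

lemma runSum_mem_Icc {a : ℝ}
    (h : ∀ t < T, ∀ s, s.Valid T C → ∀ x, f t s x ∈ Set.Icc 0 a) :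
    ∀ n ≤ T, ∀ ω, runSum T C c η ℓ f n ω ∈ Set.Icc 0 (n * a)
  | 0, _, _ => by simp [runSum]
  | n + 1, hn, ω => by
      have hpast := runSum_mem_Icc h n (by lia) (Fin.init ω)
      have hround := h n hn _ (hv n (by lia) (Fin.init ω)) (ω (Fin.last n))
      rw [Nat.cast_add_one, add_one_mul]
      exact ⟨add_nonneg hpast.1 hround.1, add_le_add hpast.2 hround.2⟩

end

end RunMean

/-! ### The regret -/

section Regret

variable {K κ T : ℕ} {G : Digraph (Fin K)} {C : Fin κ → Finset (Fin K)} {c η : ℝ}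
  {ℓ : ℕ → Fin K → ℝ} (hS : Setting T G C)
  (hv : ∀ n ≤ T, ∀ ω, (stateAfter T G C c η ℓ n ω).Valid T C)

include hS hv

lemma runMean_runSum_armEst (i : Fin K) :
    runMean (G := G) T C c η ℓ T (runSum T C c η ℓ (fun t s x => armEst C i (ℓ t) s x) T)
      = armLoss T ℓ i := by
  rw [runMean_runSum hv T le_rfl]
  refine sum_congr rfl fun t ht => ?_
  have ht := (mem_range.1 ht).le
  simp only [(hv t ht _).roundMean_armEst hS, runMean_const hv _ t ht]

lemma regret_add_armLoss_eq (i : Fin K) :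
    regret T G C c η ℓ i + armLoss T ℓ i
      = runMean (G := G) T C c η ℓ T
        (runSum T C c η ℓ (fun t s x => s.p ⬝ᵥ metaEst C (ℓ t) s x) T) :=
  calc regret T G C c η ℓ i + armLoss T ℓ i
      = runMean T C c η ℓ T fun ω => (∑ t : Fin T, ℓ t (ω t).2 - armLoss T ℓ i)
          + armLoss T ℓ i := by
        rw [runMean_add, runMean_const hv _ T le_rfl]
        rfl
    _ = runMean T C c η ℓ T (runSum T C c η ℓ (fun t _ x => ℓ t x.2) T) := by
        congr 1
        funext ω
        rw [sub_add_cancel, runSum_eq_sum fun t (x : Choice G κ) => ℓ t x.2]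
    _ = runMean T C c η ℓ T
          (runSum T C c η ℓ (fun t s x => s.p ⬝ᵥ metaEst C (ℓ t) s x) T) := by
        rw [runMean_runSum hv T le_rfl, runMean_runSum hv T le_rfl]
        refine sum_congr rfl fun t ht => ?_
        simp only [(hv t (mem_range.1 ht).le _).roundMean_dotProduct_metaEst hS]

variable (hℓ : ∀ t < T, ∀ i, ℓ t i ∈ Set.Icc (0 : ℝ) 1) {Q : ℝ} {i : Fin K}
  {mix : Fin K → ℝ} (hmix : ∀ i, 0 ≤ mix i) {P : State G κ → ℝ → ℝ → Prop}

include hℓ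

lemma runSum_dotProduct_metaEst_mem_Icc (ω : Fin T → Choice G κ) :
    runSum T C c η ℓ (fun t s x => s.p ⬝ᵥ metaEst C (ℓ t) s x) T ω
      ∈ Set.Icc (0 : ℝ) (T * T) :=
  runSum_mem_Icc hv (fun t ht _ hs x => ⟨hs.dotProduct_metaEst_nonneg hS (hℓ t ht) x,
    hs.dotProduct_metaEst_le_horizon hS (hℓ t ht) x⟩) T le_rfl ω

include hmix

lemma runMean_runSum_slack_le (hmix1 : ∑ i, mix i ≤ 1) :
    runMean (G := G) T C c η ℓ T (runSum T C c η ℓ (fun t s x => slack T C mix (ℓ t) s x) T)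
      ≤ metaCard G κ + 1 := by
  have hT : (T : ℝ) ≠ 0 := by exact_mod_cast hS.T_pos.ne'
  rw [runMean_runSum hv T le_rfl]
  calc ∑ t ∈ range T, runMean T C c η ℓ t (fun ω => roundMean (stateAfter T G C c η ℓ t ω)
        fun x => slack T C mix (ℓ t) (stateAfter T G C c η ℓ t ω) x)
      ≤ ∑ _t ∈ range T, 1 / (T : ℝ) * (metaCard G κ + 1) := sum_le_sum fun t ht => by
        have ht := mem_range.1 ht
        rw [← runMean_const hv (1 / (T : ℝ) * (metaCard G κ + 1)) t ht.le]
        exact runMean_mono hv ht.le fun ω => (hv t ht.le ω).roundMean_slack_le hS hmix hmix1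
          fun i => (hℓ t ht i).2
    _ = metaCard G κ + 1 := by
        rw [sum_const, card_range, nsmul_eq_mul]
        field_simp

lemma runInv_stateAfter (hη : 0 < η) (hP : EpochBound T C c Q i mix P) :
    ∀ n ≤ T, ∀ ω, ∃ Yc Wc, RunInv c Q η P (stateAfter T G C c η ℓ n ω)
      (runSum T C c η ℓ (fun t s x => s.p ⬝ᵥ metaEst C (ℓ t) s x) n ω)
      (runSum T C c η ℓ (fun t s x => armEst C i (ℓ t) s x) n ω)
      (runSum T C c η ℓ (fun t s x => slack T C mix (ℓ t) s x) n ω) Yc Wc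
  | 0, _, _ => ⟨0, 0, runInv_restart hP hη⟩
  | n + 1, hn, ω => by
      obtain ⟨Yc, Wc, h⟩ := runInv_stateAfter hη hP n (by lia) (Fin.init ω)
      exact h.step hS hP hη hmix (hv n (by lia) _) (hℓ n hn) (ω (Fin.last n))

lemma regret_le_of_epochBound (hmix1 : ∑ i, mix i ≤ 1) (hc : 0 ≤ c) (hη : 0 < η)
    (hη1 : η ≤ 1) (hQ : 0 ≤ Q) (hP : EpochBound T C c Q i mix P) :
    regret T G C c η ℓ i ≤ Q * ((κ + 1) / η
      + 4 * √((κ + 1) * (regret T G C c η ℓ i + armLoss T ℓ i))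
      + 4 * (c * metaCard G κ * log (K * T))) + (metaCard G κ + 1) := by
  set Z := runSum T C c η ℓ (fun t (s : State G κ) x => s.p ⬝ᵥ metaEst C (ℓ t) s x) T with hZ
  set Y := runSum T C c η ℓ (fun t (s : State G κ) x => armEst C i (ℓ t) s x) T with hY
  set W := runSum T C c η ℓ (fun t (s : State G κ) x => slack T C mix (ℓ t) s x) T
  have hZmem : ∀ ω, Z ω ∈ Set.Icc (0 : ℝ) (T * T) :=
    runSum_dotProduct_metaEst_mem_Icc hS hv hℓ
  have hpath : ∀ ω, Z ω ≤ Q * ((κ + 1) / η + 4 * (c * metaCard G κ * log (K * T)))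
      + (Y ω + (W ω + 4 * Q * √((κ + 1) * Z ω))) := fun ω => by
    obtain ⟨Yc, Wc, h⟩ := runInv_stateAfter hS hv hℓ hmix hη hP T le_rfl ω
    linarith [h.regret_le hS hP hQ hc hη hη1 (hv T le_rfl ω) (by linarith [(hZmem ω).2])]
  have hmean := runMean_mono hv le_rfl hpath
  rw [runMean_add, runMean_add, runMean_add, runMean_const hv _ T le_rfl, runMean_mul_left,
    hY, runMean_runSum_armEst hS hv] at hmean
  have hsqrt := runMean_sqrt_le hv le_rfl (F := fun ω => ((κ : ℝ) + 1) * Z ω)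
    fun ω => mul_nonneg (by positivity) (hZmem ω).1
  rw [runMean_mul_left, hZ, ← regret_add_armLoss_eq hS hv i] at hsqrt
  rw [hZ, ← regret_add_armLoss_eq hS hv i] at hmean
  linarith [runMean_runSum_slack_le hS hv hℓ hmix hmix1,
    mul_le_mul_of_nonneg_left hsqrt (by linarith : 0 ≤ 4 * Q)]

end Regret

lemma exists_epochBound {K κ T : ℕ} {G : Digraph (Fin K)} {C : Fin κ → Finset (Fin K)}
    (hS : Setting T G C) {c : ℝ} (hc : 8 ≤ c) (i : Fin K) :
    ∃ (mix : Fin K → ℝ) (P : State G κ → ℝ → ℝ → Prop), (∀ i, 0 ≤ mix i) ∧ ∑ i, mix i ≤ 1 ∧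
      EpochBound T C c (800 * log (K * T) ^ 3) i mix P := by
  by_cases hi : i ∈ inNbrs G i
  · obtain ⟨j, hj⟩ := (hS.partition.covers i).2 hi
    have hmem := hedgeInit_mem hS.T_pos ⟨i, hj⟩
    exact ⟨_, _, hmem.1.1, hmem.1.2.le, epochBound_clique hS hc hj⟩
  · exact ⟨0, _, fun _ => le_rfl, by simp, epochBound_noLoop hS hc ⟨i, hi⟩⟩

lemma le_of_le_add_mul_sqrt {R A B a L : ℝ} (hA : 0 ≤ A) (hB : 0 ≤ B) (ha : 0 ≤ a)
    (hL : 0 ≤ L) (h : R ≤ A + B * √(a * (R + L))) : R ≤ 2 * A + 2 * B * √(a * L) + B ^ 2 * a := by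
  rcases le_total R 0 with hR | hR
  · exact hR.trans (by positivity)
  · have hsqrt : √(a * (R + L)) ≤ √a * √R + √(a * L) := by
      rw [mul_add, ← sqrt_mul ha]
      simpa only [sqrt_eq_rpow] using
        rpow_add_le_add_rpow (mul_nonneg ha hR) (mul_nonneg ha hL) (by norm_num) (by norm_num)
    have hamgm := two_mul_le_add_sq (B * √a) √R
    rw [mul_pow, sq_sqrt ha, sq_sqrt hR] at hamgm
    linarith [mul_le_mul_of_nonneg_left hsqrt hB]

lemma regret_le {K κ T : ℕ} {G : Digraph (Fin K)} {C : Fin κ → Finset (Fin K)}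
    (hS : Setting T G C) {ℓ : ℕ → Fin K → ℝ} (hℓ : ∀ t < T, ∀ i, ℓ t i ∈ Set.Icc (0 : ℝ) 1)
    {c η : ℝ} (hc : 8 ≤ c) (hη : 0 < η) (hη1 : η * (2000 * log T * log (K * T) ^ 2) ≤ 1)
    (i : Fin K) :
    regret T G C c η ℓ i ≤
      2 * (800 * log (K * T) ^ 3 * ((κ + 1) / η + 4 * (c * metaCard G κ * log (K * T)))
        + (metaCard G κ + 1))
      + 2 * (3200 * log (K * T) ^ 3) * √((κ + 1) * armLoss T ℓ i)
      + (3200 * log (K * T) ^ 3) ^ 2 * (κ + 1) := by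
  have hlog := hS.two_le_log
  have hv := valid_stateAfter hS (by linarith : 4 ≤ c) hη hη1 hℓ
  have hη_le := hS.mul_rate_le_one hη hη1
  obtain ⟨mix, P, hmix, hmix1, hP⟩ := exists_epochBound hS hc i
  have harm : 0 ≤ armLoss T ℓ i := sum_nonneg fun t ht => (hℓ t (mem_range.1 ht) i).1
  refine le_of_le_add_mul_sqrt (by positivity) (by positivity) (by positivity) harm ?_
  linarith [regret_le_of_epochBound hS hv hℓ hmix hmix1 (by linarith) hη (by linarith)
    (by positivity) hP]

lemma Setting.add_div_rate_le {K κ T : ℕ} {G : Digraph (Fin K)} {C : Fin κ → Finset (Fin K)}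
    (hS : Setting T G C) {S : ℝ} (hS0 : 0 ≤ S) :
    S + ((κ + 1) / (1 / (2000 * log T * log (K * T) ^ 2 + 80 * κ * log T))
        + 64 * metaCard G κ * metaCard G κ)
      ≤ 4224 * log (K * T) ^ 3 * (S + metaCard G κ ^ 2) := by
  have hβ := hS.one_le_metaCard
  have hκβ : (κ : ℝ) ≤ metaCard G κ := by exact_mod_cast kappa_le_metaCard
  have hlT := hS.log_le_log
  have hl := hS.one_le_log
  have hL := hS.two_le_log
  set β : ℝ := (metaCard G κ : ℝ)
  set L := log (K * T)
  have hL3 : 1 ≤ L ^ 3 := one_le_pow₀ (by linarith)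
  have hentropy : log T * L ^ 2 ≤ L ^ 3 * β :=
    calc log T * L ^ 2 ≤ L * L ^ 2 := by gcongr
      _ ≤ L ^ 3 * β := by rw [← pow_succ']; exact le_mul_of_one_le_right (by positivity) hβ
  have hbarrier : κ * log T ≤ β * L ^ 3 := by
    gcongr
    exact hlT.trans (le_self_pow₀ (by linarith) (by norm_num))
  rw [div_div_eq_mul_div, div_one]
  calc S + ((κ + 1) * (2000 * log T * L ^ 2 + 80 * κ * log T) + 64 * β * β)
      ≤ 4224 * L ^ 3 * S + ((β + β) * (2080 * L ^ 3 * β) + 64 * β * β * L ^ 3) := by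
        refine add_le_add (le_mul_of_one_le_left hS0 (by linarith)) (add_le_add
          (mul_le_mul (by linarith) (by linarith) (by positivity) (by positivity))
          (le_mul_of_one_le_right (by positivity) hL3))
    _ = 4224 * L ^ 3 * (S + β ^ 2) := by ring

lemma add_powers_le {L S x y a b : ℝ} (hL : 1 ≤ L) (hS : 0 ≤ S) (hx : 0 ≤ x) (hy : 0 ≤ y)
    (ha : a ≤ x) (hb : b ≤ y) :
    2 * (800 * L ^ 3 * (x + 4 * (y * L)) + b) + 2 * (3200 * L ^ 3) * S + (3200 * L ^ 3) ^ 2 * a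
      ≤ 11000000 * L ^ 6 * (S + (x + y)) := by
  have h3 : L ^ 3 ≤ L ^ 6 := pow_le_pow_right₀ hL (by norm_num)
  have h4 : L ^ 4 ≤ L ^ 6 := pow_le_pow_right₀ hL (by norm_num)
  have hb6 : b ≤ L ^ 6 * y := hb.trans (le_mul_of_one_le_left hy (one_le_pow₀ hL))
  have hL6 : 0 ≤ L ^ 6 := by positivity
  calc 2 * (800 * L ^ 3 * (x + 4 * (y * L)) + b) + 2 * (3200 * L ^ 3) * S
        + (3200 * L ^ 3) ^ 2 * a
      = 1600 * (L ^ 3 * x) + 6400 * (L ^ 4 * y) + 2 * b + 6400 * (L ^ 3 * S)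
        + 10240000 * (L ^ 6 * a) := by ring
    _ ≤ 1600 * (L ^ 6 * x) + 6400 * (L ^ 6 * y) + 2 * (L ^ 6 * y) + 6400 * (L ^ 6 * S)
        + 10240000 * (L ^ 6 * x) := by gcongr
    _ ≤ 11000000 * L ^ 6 * (S + (x + y)) := by
        linarith [mul_nonneg hL6 hx, mul_nonneg hL6 hy, mul_nonneg hL6 hS]

end

end GraphBandit

theorem mainTheorem8_general {K T κ : ℕ} (hK : 2 ≤ K) (hT : 2 * K ≤ T) {G : Digraph (Fin K)}
    (hG : GraphBandit.StronglyObservable G) {C : Fin κ → Finset (Fin K)}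
    (hC : GraphBandit.IsCliquePartition G C) {ℓ : ℕ → Fin K → ℝ}
    (hℓ : ∀ t < T, ∀ i, ℓ t i ∈ Set.Icc (0 : ℝ) 1) {c η : ℝ} (hc : 8 ≤ c) (hη : 0 < η)
    (hη1 : η * (2000 * Real.log T * Real.log (K * T) ^ 2) ≤ 1) (i : Fin K) :
    GraphBandit.regret T G C c η ℓ i ≤
      11000000 * Real.log (K * T) ^ 6 * (√((κ + 1) * GraphBandit.armLoss T ℓ i)
        + ((κ + 1) / η + c * GraphBandit.metaCard G κ)) := by
  have hS : GraphBandit.Setting T G C := ⟨hK, hT, hG, hC⟩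
  have hβ := hS.one_le_metaCard
  have hη_le := hS.mul_rate_le_one hη hη1
  refine (GraphBandit.regret_le hS hℓ hc hη hη1 i).trans (GraphBandit.add_powers_le
    (by linarith [hS.two_le_log]) (Real.sqrt_nonneg _) (by positivity) (by positivity) ?_ ?_)
  · exact le_div_self (by positivity) hη (by linarith)
  · linarith [mul_le_mul_of_nonneg_right hc (zero_le_one.trans hβ)]

theorem mainTheorem8 :
    ∃ (A : ℝ) (m : ℕ), ∀ (K T κ : ℕ), 2 ≤ K → 2 * K ≤ T →
      ∀ (G : Digraph (Fin K)), GraphBandit.StronglyObservable G →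
      ∀ (C : Fin κ → Finset (Fin K)), GraphBandit.IsCliquePartition G C →
      ∀ (ℓ : ℕ → Fin K → ℝ), (∀ t < T, ∀ i, ℓ t i ∈ Set.Icc (0 : ℝ) 1) →
      ∀ (iStar : Fin K),
        (∀ i, GraphBandit.armLoss T ℓ iStar ≤ GraphBandit.armLoss T ℓ i) →
        GraphBandit.regret T G C (64 * (GraphBandit.metaCard G κ : ℝ))
            (1 / (2000 * Real.log T * Real.log ((K : ℝ) * T) ^ 2 + 80 * κ * Real.log T))
            ℓ iStar ≤
          A * Real.log ((K : ℝ) * T) ^ m *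
            (√(((κ : ℝ) + 1) * GraphBandit.armLoss T ℓ iStar)
              + (GraphBandit.metaCard G κ : ℝ) ^ 2) := by
  refine ⟨11000000 * 4224, 9, fun K T κ hK hT G hG C hC ℓ hℓ i _ => ?_⟩
  have hS : GraphBandit.Setting T G C := ⟨hK, hT, hG, hC⟩
  have hlogT := hS.one_le_log
  have hlogKT := hS.two_le_log
  set D := 2000 * Real.log T * Real.log (K * T) ^ 2 + 80 * κ * Real.log T with hD
  have hD_pos : 0 < D := by positivity
  have hrate : 1 / D * (2000 * Real.log T * Real.log (K * T) ^ 2) ≤ 1 := by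
    rw [one_div_mul_eq_div, div_le_one hD_pos, hD]
    exact le_add_of_nonneg_right (by positivity)
  calc GraphBandit.regret T G C (64 * GraphBandit.metaCard G κ) (1 / D) ℓ i
      ≤ 11000000 * Real.log (K * T) ^ 6 * (√((κ + 1) * GraphBandit.armLoss T ℓ i)
          + ((κ + 1) / (1 / D) + 64 * GraphBandit.metaCard G κ * GraphBandit.metaCard G κ)) :=
        mainTheorem8_general hK hT hG hC hℓ (by linarith [hS.one_le_metaCard]) (by positivity)
          hrate i
    _ ≤ 11000000 * Real.log (K * T) ^ 6 * (4224 * Real.log (K * T) ^ 3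
          * (√((κ + 1) * GraphBandit.armLoss T ℓ i) + GraphBandit.metaCard G κ ^ 2)) := by
        gcongr
        exact hS.add_div_rate_le (Real.sqrt_nonneg _)
    _ = 11000000 * 4224 * Real.log (K * T) ^ 9 * (√((κ + 1) * GraphBandit.armLoss T ℓ i)
          + GraphBandit.metaCard G κ ^ 2) := by ring
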